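/- Let $T_d$ ($d\ge 1$) be the perfect binary tree with $d$ layers, numbered from the leaves (layer $1$, with $k=2^{d-1}$ leaves) to the root (layer $d$). Each leaf carries a data fragment (a vector of $D\ge1$ bits), and each other vertex carries the bitwise XOR of the fragments of its two children. A subset $S$ of the vertices is decodable if the fragments of its vertices ("present" vertices; the others are "missing") determine all data fragments. A missing-vertex path is a path in the tree all of whose vertices are missing. A present vertex $x$ recovers a leaf $y$ if there is a missing-vertex path from a child of $x$ down to $y$; the fragments communicated to $x$ are then those of the present proper descendants $z$ of $x$ with no present vertex strictly between $z$ and $x$. A present leaf is recovered with $0$ communicated fragments. The total communication cost of $S$ is the sum, over the present vertices that recover some leaf, of the number of fragments communicated to them. Let $p_1,p_2,\ldots\in[0,1]$, and include each vertex of layer $l$ in the random subset with probability $p_l$, independently of all other vertices. For $i\ge1$ and integers $N\ge 0$, fix a data fragment (leaf) $y$ of $T_i$ and define: - $Q_i$: the probability that the subset of $T_i$ is decodable; - $P_i(N)$: the probability that the subset of $T_i$ is decodable and $y$ is recovered with $N$ communicated fragments; - $A_i(N)$: the conditional probability of the event in the definition of $P_i(N)$, given that the root is present and that there is a missing-vertex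 path from one of its children to $y$ (for $i\ge 2$ this is understood as the law in which the root is present, the vertices on the path from a child of the root to $y$ are missing, and all other vertices are included independently as before, so that it makes sense also if the condition has probability $0$; for $i=1$ the condition is impossible and $A_1(N)=0$); - $F_i(N)$: the probability that the subset of $T_i$ is decodable and exactly $N$ present vertices have no present proper ancestor. Then $P_i(N)$ and $A_i(N)$ do not depend on the choice of $y$, and the following hold (with $A_i(m)=0$ for $m<0$). (a) $P_1(0)=p_1$, $P_1(N)=0$ for $N>0$, and for $i>1$ $$P_i(N)=Q_{i-1}P_{i-1}(N)+A_i(N)\,p_i\prod_{l=1}^{i-1}(1-p_l)+p_i\prod_{l=1}^{i-1}(1-p_l)\sum_{j=1}^{i-1}\Big[2^{j-1}P_j(N)\prod_{\ell=1,\,\ell\ne j}^{i-1}Q_\ell\Big].$$ (b) $A_1(N)=0$ for all $N$, $A_2(1)=p_1$, $A_2(N)=0$ for $N\neq1$, and for $i>2$ $$A_i(N)=\sum_{l=1}^{2^{i-2}}F_{i-1}(l)\,A_{i-1}(N-l).$$ (c) $F_1(1)=p_1$, $F_1(N)=0$ for $N>1$, and for $i>1$ $$F_i(N)=(1-p_i)\sum_{l=1}^{N-1}F_{i-1}(l)F_{i-1}(N-l)\quad(N>1),\qquad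 F_i(1)=p_i\Big[Q_{i-1}^2+2^{i-1}\prod_{j=1}^{i-1}\big[(1-p_j)Q_j\big]\Big].$$ (d) If $Q_d>0$, let $C_d(N)$ be the conditional probability, given that the subset of $T_d$ is decodable, that $y$ is recovered with $N$ communicated fragments, and let $E$ be the expected total communication cost given that the subset of $T_d$ is decodable. Then $$E=2^{d-1}\sum_{N\ge0}N\,C_d(N)=2^{d-1}\,\frac{\sum_{N\ge 0}N\,P_d(N)}{Q_d}.$$ -/

import Mathlib

namespace Treeplication

/-- Vertices of the perfect binary tree `T_n` with `n` layers (`T_0` is empty): the root,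
or a vertex of one of the two immediate subtrees of the root. -/
inductive Vertex : ℕ → Type
  | root (n : ℕ) : Vertex (n + 1)
  | child {n : ℕ} (b : Bool) (v : Vertex n) : Vertex (n + 1)

namespace Vertex

/-- The layer of a vertex; layers are numbered from the bottom (leaves: `1`) to the root of
`T_n` (`n`). -/
def layer : {n : ℕ} → Vertex n → ℕ
  | _, .root n => n + 1
  | _, .child _ v => v.layer

/-- `StrictlyBelow v u`: the vertex `v` is a proper descendant of the vertex `u`. -/
def StrictlyBelow : {n : ℕ} → Vertex n → Vertex n → Prop
  | _, .child _ _, .root _ => True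
  | _, .child b v, .child c u => b = c ∧ StrictlyBelow v u
  | _, .root _, _ => False

/-- A vertex of `T_{n+1}` is the root or a pair (side, vertex of that immediate subtree). -/
def succEquiv (n : ℕ) : Vertex (n + 1) ≃ Option (Bool × Vertex n) where
  toFun v := match v with
    | .root _ => none
    | .child b w => some (b, w)
  invFun o := match o with
    | none => .root n
    | some (b, w) => .child b w
  left_inv v := by cases v <;> rfl
  right_inv o := by rcases o with _ | ⟨b, w⟩ <;> rfl

instance instIsEmptyZero : IsEmpty (Vertex 0) := ⟨fun v => nomatch v⟩

noncomputable instance instDecidableEq (n : ℕ) : DecidableEq (Vertex n) := Classical.decEq _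

theorem finite_vertex : (n : ℕ) → Finite (Vertex n)
  | 0 => inferInstance
  | n + 1 => by
      have := finite_vertex n
      exact Finite.of_equiv _ (succEquiv n).symm

noncomputable instance instFintype (n : ℕ) : Fintype (Vertex n) :=
  haveI := finite_vertex n
  Fintype.ofFinite _

end Vertex

/-- The leaves of `T_n`; they index the data fragments. -/
abbrev Leaf (n : ℕ) : Type := {v : Vertex n // v.layer = 1}

/-- A leaf of an immediate subtree, as a leaf of the whole tree. -/
def Leaf.child {n : ℕ} (b : Bool) (y : Leaf n) : Leaf (n + 1) := ⟨.child b y.1, y.2⟩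

/-- A fragment of `D` bits; addition is bitwise exclusive-or. -/
abbrev Fragment (D : ℕ) : Type := Fin D → ZMod 2

/-- The code fragment of a vertex: at a leaf it is the data fragment, at any other vertex it is
the bitwise exclusive-or of the code fragments of its two children. -/
def codeFragment {D : ℕ} : {n : ℕ} → (Leaf n → Fragment D) → Vertex n → Fragment D
  | 1, x, .root 0 => x ⟨.root 0, rfl⟩
  | n + 2, x, .root (_ + 1) =>
      codeFragment (fun y => x (Leaf.child false y)) (.root n) +
        codeFragment (fun y => x (Leaf.child true y)) (.root n)
  | _ + 1, x, .child b v => codeFragment (fun y => x (Leaf.child b y)) v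

section Subsets

variable {n : ℕ}

/-- A Treeplication subset is decodable if its code fragments suffice to recover all data
fragments. -/
def Decodable (D : ℕ) (S : Finset (Vertex n)) : Prop :=
  ∃ decoder : ({v : Vertex n // v ∈ S} → Fragment D) → (Leaf n → Fragment D),
    ∀ x : Leaf n → Fragment D, decoder (fun v => codeFragment x v.1) = x

/-- There is a missing-vertex path from a child of `x` down to `y`: the vertex `y` lies strictly
below `x`, and all vertices on the path from `y` upwards, up to the child of `x`, are missing. -/
def MissingPath (S : Finset (Vertex n)) (x y : Vertex n) : Prop :=
  y.StrictlyBelow x ∧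
    ∀ v : Vertex n, (v = y ∨ y.StrictlyBelow v) → v.StrictlyBelow x → v ∉ S

/-- The present vertex `x` recovers the (missing) leaf `y`. -/
def Recovers (S : Finset (Vertex n)) (x : Vertex n) (y : Leaf n) : Prop :=
  x ∈ S ∧ MissingPath S x y.1

open Classical in
/-- The present vertices which are reached when every downward path from `x` is traversed until
the first present vertex: these fragments are communicated to `x` if `x` recovers a leaf. -/
noncomputable def reached (S : Finset (Vertex n)) (x : Vertex n) : Finset (Vertex n) :=
  S.filter fun z => z.StrictlyBelow x ∧
    ∀ v : Vertex n, z.StrictlyBelow v → v.StrictlyBelow x → v ∉ S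

/-- The data fragment `y` is recovered with `N` communicated code fragments: either the leaf `y`
is present and `N = 0`, or `y` is recovered by a present vertex that receives `N` fragments. -/
def RecoveredWith (S : Finset (Vertex n)) (y : Leaf n) (N : ℕ) : Prop :=
  (y.1 ∈ S ∧ N = 0) ∨ ∃ x : Vertex n, Recovers S x y ∧ (reached S x).card = N

open Classical in
/-- The total communication cost returned by the fragment-recovery algorithm: the sum, over the
present vertices that recover some leaf, of the number of fragments communicated to them. -/
noncomputable def totalCost (S : Finset (Vertex n)) : ℕ :=
  ∑ x ∈ S.filter (fun x => ∃ y : Leaf n, Recovers S x y), (reached S x).card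

open Classical in
/-- The present vertices with no present (proper) ancestor. -/
noncomputable def topPresent (S : Finset (Vertex n)) : Finset (Vertex n) :=
  S.filter fun v => ∀ u : Vertex n, v.StrictlyBelow u → u ∉ S

/-- The probability of the subset `S` when every vertex `v` is included with probability `q v`,
independently of the other vertices. -/
noncomputable def weight (q : Vertex n → ℝ) (S : Finset (Vertex n)) : ℝ :=
  ∏ v : Vertex n, if v ∈ S then q v else 1 - q v

open Classical in
/-- The probability of the event `E` when every vertex `v` is included with probability `q v`,
independently of the other vertices. -/
noncomputable def prob (q : Vertex n → ℝ) (E : Finset (Vertex n) → Prop) : ℝ :=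
  ∑ S : Finset (Vertex n), if E S then weight q S else 0

end Subsets

/-- Inclusion probabilities that depend on the layer only. -/
def layerProb (p : ℕ → ℝ) (n : ℕ) (v : Vertex n) : ℝ := p v.layer

/-- `Q_i`: the probability that a subset of `T_i` is decodable. -/
noncomputable def decodableProb (D : ℕ) (p : ℕ → ℝ) (i : ℕ) : ℝ :=
  prob (layerProb p i) (fun S => Decodable D S)

/-- `P_i(N)` for the data fragment `y`: the probability that a subset of `T_i` is decodable and
`y` is recovered with `N` communicated fragments. -/
noncomputable def jointProb (D : ℕ) (p : ℕ → ℝ) (i : ℕ) (y : Leaf i) (N : ℕ) : ℝ :=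
  prob (layerProb p i) (fun S => Decodable D S ∧ RecoveredWith S y N)

/-- `C_i(N)` for the data fragment `y`: the probability, conditioned on decodability, that `y` is
recovered with `N` communicated fragments. -/
noncomputable def condProb (D : ℕ) (p : ℕ → ℝ) (i : ℕ) (y : Leaf i) (N : ℕ) : ℝ :=
  prob (layerProb p i) (fun S => RecoveredWith S y N ∧ Decodable D S) /
    prob (layerProb p i) (fun S => Decodable D S)

/-- The root (the vertex of layer `i`) of `T_i` is present, and there is a missing-vertex path
from one of its children to the leaf `y`. -/
def RootPath {i : ℕ} (S : Finset (Vertex i)) (y : Leaf i) : Prop :=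
  ∃ x : Vertex i, x.layer = i ∧ Recovers S x y

open Classical in
/-- The inclusion probabilities of the conditional law given that the root is present and the
vertices on the path from a child of the root to `y` are missing: by independence, the root is
included with probability `1`, the vertices of the path with probability `0`, and all other
vertices as before. (This makes sense also if the condition has probability zero.) -/
noncomputable def rootPathProb (p : ℕ → ℝ) {i : ℕ} (y : Leaf i) (v : Vertex i) : ℝ :=
  if v.layer = i then 1
  else if v = y.1 ∨ y.1.StrictlyBelow v then 0
  else p v.layer

/-- `A_i(N)` for the data fragment `y`: the probability that a subset of `T_i` is decodable and
`y` is recovered with `N` communicated fragments, given that the root is present and that there is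
a missing-vertex path from one of its children to `y`. (For `i = 1` the condition is impossible,
and the value is `0`.) -/
noncomputable def rootCondProb (D : ℕ) (p : ℕ → ℝ) (i : ℕ) (y : Leaf i) (N : ℕ) : ℝ :=
  prob (rootPathProb p y) (fun S => RootPath S y ∧ Decodable D S ∧ RecoveredWith S y N)

/-- `F_i(N)`: the probability that a subset of `T_i` is decodable and has exactly `N` present
vertices with no present ancestors. -/
noncomputable def topProb (D : ℕ) (p : ℕ → ℝ) (i N : ℕ) : ℝ :=
  prob (layerProb p i) (fun S => Decodable D S ∧ (topPresent S).card = N)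

open Classical in
/-- The expected total communication cost of the fragment-recovery algorithm on `T_d`,
conditioned on decodability. -/
noncomputable def expectedCost (D : ℕ) (p : ℕ → ℝ) (d : ℕ) : ℝ :=
  (∑ S : Finset (Vertex d),
      if Decodable D S then weight (layerProb p d) S * (totalCost S : ℝ) else 0) /
    decodableProb D p d

end Treeplication

/-! Cut the tree at its root: a subset of `T_{n+1}` is the state of the root together with two
independent subsets of `T_n`. Decodability is linear algebra over `ZMod 2`: only zero data may give
zero fragments on the whole subset. If the root is missing, both halves must be decodable. If it is
present, one half must be decodable and the other at least `DecodableWithRoot`; otherwise both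
halves carry undetected data whose root fragments can be made equal, and these cancel in the root
(`decodable_join_true`).

A half that really needs its root fragment has a single missing path from its root to a leaf, and
every subtree hanging off that path is decodable. This gives the closed form `rootNeededProb_eq`
and, once the cost of a leaf `y` is recorded, a sum over the layer of the hanging subtree that
contains `y` (`rootNeededJointProb_eq`). For `P`, either the root recovers `y`, which gives the term
in `A` by a change of law, or `y` is recovered inside its own half (`jointProb_succ`). For `A`, the
half of `y` has an open path, hence is not decodable, so the other half is; the fragments reached in
the two halves add up, whence a convolution with `F`.

For the cost, a vertex of a decodable set recovers at most one leaf (`Recovers.leaf_unique`) and a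
leaf is recovered by at most one vertex (`Recovers.unique`). The total cost is thus a sum over the
leaves, all of which have the same expected cost. -/

namespace Treeplication

/-! ### Vertices, layers and the descendant relation -/

namespace Vertex

variable {n : ℕ}

@[simp] theorem layer_root : (root n).layer = n + 1 := rfl

@[simp] theorem layer_child (b : Bool) (v : Vertex n) : (child b v).layer = v.layer := rfl

theorem layer_le : ∀ {n : ℕ} (v : Vertex n), v.layer ≤ n
  | _, .root n => le_rfl
  | _, .child _ v => (layer_le v).trans (Nat.le_succ _)

theorem layer_eq_iff {v : Vertex (n + 1)} : v.layer = n + 1 ↔ v = root n := by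
  cases v with
  | root => simp
  | child b w =>
    have := layer_le w
    simp only [layer_child, reduceCtorEq, iff_false]
    omega

@[simp] theorem child_strictlyBelow_root (b : Bool) (v : Vertex n) :
    (child b v).StrictlyBelow (root n) ↔ True := Iff.rfl

@[simp] theorem child_strictlyBelow_child (b c : Bool) (v u : Vertex n) :
    (child b v).StrictlyBelow (child c u) ↔ b = c ∧ v.StrictlyBelow u := Iff.rfl

@[simp] theorem not_root_strictlyBelow (u : Vertex (n + 1)) :
    (root n).StrictlyBelow u ↔ False := by
  cases u <;> exact Iff.rfl

/-- Naming the sides `b` and `!b` lets `b` be the side of a given leaf, so that later arguments need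
no reduction by symmetry. -/
theorem forall_vertex_succ {P : Vertex (n + 1) → Prop} (b : Bool) :
    (∀ v, P v) ↔ P (root n) ∧ (∀ v, P (child b v)) ∧ ∀ v, P (child (!b) v) := by
  refine ⟨fun h => ⟨h _, fun v => h _, fun v => h _⟩, fun ⟨h, h₁, h₂⟩ v => ?_⟩
  cases v with
  | root => exact h
  | child c w =>
    by_cases hc : c = b
    · subst hc; exact h₁ w
    · have : c = !b := by cases b <;> cases c <;> simp_all
      subst this; exact h₂ w

theorem exists_vertex_succ {P : Vertex (n + 1) → Prop} (b : Bool) :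
    (∃ v, P v) ↔ P (root n) ∨ (∃ v, P (child b v)) ∨ ∃ v, P (child (!b) v) := by
  have := forall_vertex_succ (P := fun v => ¬ P v) b
  rw [← not_iff_not]
  push Not
  exact this

end Vertex

open Vertex

/-! ### Splitting a subset at the root -/

section Join

variable {n : ℕ}

open Classical in
/-- The set of vertices of `T_{n+1}` that contains the root when `r` is true, and that restricts
to `S` in the subtree `b` and to `T` in the other subtree. -/
noncomputable def join (b r : Bool) (S T : Finset (Vertex n)) : Finset (Vertex (n + 1)) :=
  Finset.univ.filter fun v => match v with
    | .root _ => r = true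
    | .child c w => if c = b then w ∈ S else w ∈ T

variable (b r : Bool) (S T : Finset (Vertex n))

@[simp] theorem root_mem_join : root n ∈ join b r S T ↔ r = true := by
  simp [join]

@[simp] theorem child_mem_join (v : Vertex n) : child b v ∈ join b r S T ↔ v ∈ S := by
  simp [join]

@[simp] theorem child_not_mem_join (v : Vertex n) : child (!b) v ∈ join b r S T ↔ v ∈ T := by
  simp [join]

theorem eq_join_iff (U : Finset (Vertex (n + 1))) :
    U = join b r S T ↔ (root n ∈ U ↔ r = true) ∧ (∀ v, child b v ∈ U ↔ v ∈ S) ∧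
      ∀ v, child (!b) v ∈ U ↔ v ∈ T := by
  rw [Finset.ext_iff, forall_vertex_succ b]
  simp

theorem join_swap : join (!b) r S T = join b r T S := by
  rw [eq_join_iff]
  refine ⟨by simp, fun v => ?_, by simp⟩
  simpa using child_not_mem_join (!b) r S T v

theorem insert_root_join : insert (root n) (join b r S T) = join b true S T := by
  rw [eq_join_iff]
  simp

open Classical in
/-- Subsets of `T_{n+1}` are triples: the presence of the root, and two subsets of `T_n`. -/
noncomputable def joinEquiv (n : ℕ) (b : Bool) :
    Bool × Finset (Vertex n) × Finset (Vertex n) ≃ Finset (Vertex (n + 1)) where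
  toFun t := join b t.1 t.2.1 t.2.2
  invFun U := (decide (root n ∈ U), Finset.univ.filter (fun v => child b v ∈ U),
    Finset.univ.filter (fun v => child (!b) v ∈ U))
  left_inv t := by ext <;> simp
  right_inv U := by symm; rw [eq_join_iff]; simp

theorem exists_eq_join (U : Finset (Vertex (n + 1))) : ∃ r S T, U = join b r S T :=
  ⟨_, _, _, ((joinEquiv n b).right_inv U).symm⟩

end Join

/-! ### Leaves and data of the two halves -/

section Leaves

variable {n : ℕ}

theorem Leaf.exists_eq_child (y : Leaf (n + 2)) : ∃ b z, y = Leaf.child (n := n + 1) b z := by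
  obtain ⟨v, hv⟩ := y
  cases v with
  | root => simp at hv
  | child b w => exact ⟨b, ⟨w, hv⟩, rfl⟩

theorem Leaf.eq_root (y : Leaf 1) : y = ⟨root 0, rfl⟩ := by
  refine Subtype.ext ?_
  cases y.1 with
  | root => rfl
  | child b w => exact isEmptyElim w

/-- The leaves of `T_{n+2}` are the leaves of the two immediate subtrees. -/
def leafEquiv (n : ℕ) : Bool × Leaf (n + 1) ≃ Leaf (n + 2) where
  toFun t := Leaf.child t.1 t.2
  invFun y := match y with
    | ⟨.child b w, h⟩ => (b, ⟨w, h⟩)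
    | ⟨.root _, h⟩ => absurd h (by simp)
  left_inv t := rfl
  right_inv y := by obtain ⟨b, z, rfl⟩ := y.exists_eq_child; rfl

theorem card_leaf : ∀ n : ℕ, Fintype.card (Leaf (n + 1)) = 2 ^ n
  | 0 => Fintype.card_eq_one_iff.2 ⟨_, Leaf.eq_root⟩
  | n + 1 => by
    rw [← Fintype.card_congr (leafEquiv n), Fintype.card_prod, card_leaf n, Fintype.card_bool,
      pow_succ']

/-- Data for `T_{n+2}` put together from data for the subtree `b` and for the other one. -/
def glue {α : Type*} (b : Bool) (x x' : Leaf (n + 1) → α) (y : Leaf (n + 2)) : α :=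
  if ((leafEquiv n).symm y).1 = b then x ((leafEquiv n).symm y).2
  else x' ((leafEquiv n).symm y).2

variable {α : Type*} (b : Bool) (x x' : Leaf (n + 1) → α)

@[simp] theorem glue_child (y : Leaf (n + 1)) : glue b x x' (Leaf.child b y) = x y :=
  if_pos rfl

@[simp] theorem glue_child_not (y : Leaf (n + 1)) : glue b x x' (Leaf.child (!b) y) = x' y :=
  if_neg (by cases b <;> exact Bool.noConfusion)

theorem eq_glue (x : Leaf (n + 2) → α) :
    x = glue b (fun y => x (Leaf.child b y)) (fun y => x (Leaf.child (!b) y)) := by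
  funext y
  obtain ⟨c, z, rfl⟩ := y.exists_eq_child
  by_cases hc : c = b
  · subst hc; simp
  · have : c = !b := by cases b <;> cases c <;> simp_all
    subst this; simp

end Leaves

/-! ### Linear algebra of decodability -/

section Code

variable {D n : ℕ}

theorem codeFragment_child (x : Leaf (n + 1) → Fragment D) (b : Bool) (v : Vertex n) :
    codeFragment x (child b v) = codeFragment (fun y => x (Leaf.child b y)) v := by
  cases n with
  | zero => exact isEmptyElim v
  | succ n => rfl

theorem codeFragment_root_succ (x : Leaf (n + 2) → Fragment D) (b : Bool) :
    codeFragment x (root (n + 1)) = codeFragment (fun y => x (Leaf.child b y)) (root n) +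
        codeFragment (fun y => x (Leaf.child (!b) y)) (root n) := by
  cases b
  · rfl
  · exact add_comm (codeFragment (fun y => x (Leaf.child false y)) (root n)) _

theorem codeFragment_map {D' : ℕ} (φ : Fragment D →+ Fragment D') :
    ∀ {n : ℕ} (x : Leaf n → Fragment D) (v : Vertex n),
      codeFragment (fun y => φ (x y)) v = φ (codeFragment x v)
  | 1, x, .root 0 => rfl
  | n + 2, x, .root _ => by
    rw [codeFragment_root_succ _ true, codeFragment_root_succ _ true, map_add,
      ← codeFragment_map φ, ← codeFragment_map φ]
  | n + 1, x, .child b v => by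
    rw [codeFragment_child, codeFragment_child, ← codeFragment_map φ]

theorem codeFragment_sub : ∀ {n : ℕ} (x x' : Leaf n → Fragment D) (v : Vertex n),
      codeFragment (x - x') v = codeFragment x v - codeFragment x' v
  | 1, x, x', .root 0 => rfl
  | n + 2, x, x', .root _ => by
    rw [codeFragment_root_succ _ true, codeFragment_root_succ _ true,
      codeFragment_root_succ _ true, add_sub_add_comm, ← codeFragment_sub, ← codeFragment_sub]
    rfl
  | n + 1, x, x', .child b v => by
    rw [codeFragment_child, codeFragment_child, codeFragment_child, ← codeFragment_sub]
    rfl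

theorem codeFragment_zero (v : Vertex n) : codeFragment (0 : Leaf n → Fragment D) v = 0 := by
  simpa using codeFragment_sub (0 : Leaf n → Fragment D) 0 v

/-- The code is additive, so a decoder (a left inverse) exists exactly when the kernel is trivial.
-/
theorem decodable_iff (S : Finset (Vertex n)) :
    Decodable D S ↔
      ∀ x : Leaf n → Fragment D, (∀ v ∈ S, codeFragment x v = 0) → x = 0 := by
  constructor
  · rintro ⟨f, hf⟩ x hx
    rw [← hf x, ← hf 0]
    congr 1
    funext v
    rw [hx v.1 v.2, codeFragment_zero]
  · intro h
    have hinj : Function.Injective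
        (fun (x : Leaf n → Fragment D) (v : {v : Vertex n // v ∈ S}) => codeFragment x v.1) := by
      intro x x' hx
      rw [← sub_eq_zero]
      refine h _ fun v hv => ?_
      rw [codeFragment_sub, sub_eq_zero]
      exact congrFun hx ⟨v, hv⟩
    exact ⟨_, Function.leftInverse_invFun hinj⟩

/-- Subsets of `T_{n+1}` that are decodable once the fragment of the root is known. -/
def DecodableWithRoot (D : ℕ) (S : Finset (Vertex (n + 1))) : Prop :=
  Decodable D (insert (root n) S)

theorem decodableWithRoot_iff (S : Finset (Vertex (n + 1))) :
    DecodableWithRoot D S ↔ ∀ x : Leaf (n + 1) → Fragment D,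
      (∀ v ∈ S, codeFragment x v = 0) → codeFragment x (root n) = 0 → x = 0 := by
  rw [DecodableWithRoot, decodable_iff]
  simp only [Finset.mem_insert, forall_eq_or_imp]
  exact ⟨fun h x h₁ h₂ => h x ⟨h₂, h₁⟩, fun h x hx => h x hx.2 hx.1⟩

theorem Decodable.withRoot {S : Finset (Vertex (n + 1))} (h : Decodable D S) :
    DecodableWithRoot D S :=
  (decodableWithRoot_iff S).2 fun x hx _ => (decodable_iff S).1 h x hx

theorem decodableWithRoot_join (b r : Bool) (S T : Finset (Vertex n)) :
    DecodableWithRoot D (join b r S T) ↔ Decodable D (join b true S T) := by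
  rw [DecodableWithRoot, insert_root_join]

theorem forall_mem_join (b r : Bool) (S T : Finset (Vertex (n + 1)))
    (x x' : Leaf (n + 1) → Fragment D) :
    (∀ v ∈ join b r S T, codeFragment (glue b x x') v = 0) ↔
      (r = true → codeFragment x (root n) + codeFragment x' (root n) = 0) ∧
      (∀ v ∈ S, codeFragment x v = 0) ∧ ∀ v ∈ T, codeFragment x' v = 0 := by
  rw [forall_vertex_succ b]
  simp [codeFragment_child, codeFragment_root_succ _ b]

theorem glue_eq_zero (b : Bool) (x x' : Leaf (n + 1) → Fragment D) :
    glue b x x' = 0 ↔ x = 0 ∧ x' = 0 := by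
  constructor
  · intro h
    exact ⟨funext fun y => by simpa using congrFun h (Leaf.child b y),
      funext fun y => by simpa using congrFun h (Leaf.child (!b) y)⟩
  · rintro ⟨rfl, rfl⟩
    exact (eq_glue b 0).symm

theorem decodable_join (b r : Bool) (S T : Finset (Vertex (n + 1))) :
    Decodable D (join b r S T) ↔ ∀ x x' : Leaf (n + 1) → Fragment D,
      (r = true → codeFragment x (root n) + codeFragment x' (root n) = 0) →
      (∀ v ∈ S, codeFragment x v = 0) → (∀ v ∈ T, codeFragment x' v = 0) → x = 0 ∧ x' = 0 := by
  rw [decodable_iff]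
  constructor
  · intro h x x' h₁ h₂ h₃
    rw [← glue_eq_zero b]
    exact h _ ((forall_mem_join b r S T x x').2 ⟨h₁, h₂, h₃⟩)
  · intro h x hx
    rw [eq_glue b x, forall_mem_join] at hx
    rw [eq_glue b x, glue_eq_zero]
    exact h _ _ hx.1 hx.2.1 hx.2.2

theorem decodable_join_false (b : Bool) (S T : Finset (Vertex (n + 1))) :
    Decodable D (join b false S T) ↔ Decodable D S ∧ Decodable D T := by
  rw [decodable_join, decodable_iff, decodable_iff]
  constructor
  · intro h
    exact ⟨fun x hx => (h x 0 (by simp) hx (by simp [codeFragment_zero])).1,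
      fun x hx => (h 0 x (by simp) (by simp [codeFragment_zero]) hx).2⟩
  · exact fun h x x' _ h₁ h₂ => ⟨h.1 x h₁, h.2 x' h₂⟩

/-- The homomorphism that replaces each bit of a fragment by its bit at `j`. -/
def spread (j : Fin D) : Fragment D →+ Fragment D where
  toFun f _ := f j
  map_zero' := rfl
  map_add' _ _ := rfl

/-- A nonzero kernel element has a nonzero root fragment, since knowing the root would make the set
decodable. Copying one of its nonzero bits to all positions stays in the kernel and normalises the
root fragment, so that the elements found in two halves can be matched. -/
theorem exists_codeFragment_root_eq_one {S : Finset (Vertex (n + 1))}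
    (hS : DecodableWithRoot D S) (hS' : ¬ Decodable D S) :
    ∃ x : Leaf (n + 1) → Fragment D, (∀ v ∈ S, codeFragment x v = 0) ∧
      codeFragment x (root n) = 1 := by
  rw [decodable_iff] at hS'
  push Not at hS'
  obtain ⟨x, hx, hx0⟩ := hS'
  have hr : codeFragment x (root n) ≠ 0 := fun h => hx0 ((decodableWithRoot_iff S).1 hS x hx h)
  obtain ⟨j, hj⟩ := Function.ne_iff.1 hr
  refine ⟨fun y => spread j (x y), fun v hv => ?_, ?_⟩
  · rw [codeFragment_map, hx v hv, map_zero]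
  · rw [codeFragment_map]
    funext _
    exact Fin.eq_one_of_ne_zero _ hj

/-- Setting the data of one half to zero shows that each half is decodable with its root. If neither
were decodable, both would have undetected data with root fragment 1, and these sum to zero in
characteristic two. Conversely, a decodable half has zero data, so the root reveals the root
fragment of the other half. -/
theorem decodable_join_true (hD : 1 ≤ D) (b : Bool) (S T : Finset (Vertex (n + 1))) :
    Decodable D (join b true S T) ↔
      (Decodable D S ∧ DecodableWithRoot D T) ∨ (DecodableWithRoot D S ∧ Decodable D T) := by
  constructor
  · intro h
    rw [decodable_join] at h
    have hS : DecodableWithRoot D S := (decodableWithRoot_iff S).2 fun x hx hr =>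
      (h x 0 (by simp [codeFragment_zero, hr]) hx (by simp [codeFragment_zero])).1
    have hT : DecodableWithRoot D T := (decodableWithRoot_iff T).2 fun x hx hr =>
      (h 0 x (by simp [codeFragment_zero, hr]) (by simp [codeFragment_zero]) hx).2
    by_contra hcon
    push Not at hcon
    obtain ⟨x, hx, hx1⟩ := exists_codeFragment_root_eq_one hS fun hd => hcon.1 hd hT
    obtain ⟨x', hx', hx1'⟩ := exists_codeFragment_root_eq_one hT (hcon.2 hS)
    have := (h x x' (fun _ => by rw [hx1, hx1']; funext _; exact CharTwo.add_self_eq_zero (1 : ZMod 2))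
      hx hx').1
    rw [this, codeFragment_zero] at hx1
    -- Comparing 0 with 1 requires an actual bit: here `1 ≤ D` is needed.
    exact zero_ne_one (congrFun hx1 ⟨0, hD⟩)
  · rw [decodable_join]
    rintro (⟨hS, hT⟩ | ⟨hS, hT⟩) x x' hr h₁ h₂
    · have hx := (decodable_iff S).1 hS x h₁
      subst hx
      exact ⟨rfl, (decodableWithRoot_iff T).1 hT x' h₂ (by simpa [codeFragment_zero] using hr)⟩
    · have hx := (decodable_iff T).1 hT x' h₂
      subst hx
      exact ⟨(decodableWithRoot_iff S).1 hS x h₁ (by simpa [codeFragment_zero] using hr), rfl⟩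

theorem decodable_layer_one (hD : 1 ≤ D) (S : Finset (Vertex 1)) :
    Decodable D S ↔ root 0 ∈ S := by
  rw [decodable_iff]
  constructor
  · intro h
    by_contra hS
    have := h (fun _ => 1) fun v hv => by
      cases v with
      | root => exact absurd hv hS
      | child b w => exact isEmptyElim w
    exact one_ne_zero (congrFun (congrFun this ⟨root 0, rfl⟩) ⟨0, hD⟩)
  · intro h x hx
    funext y
    rw [Leaf.eq_root y]
    exact hx _ h

theorem decodableWithRoot_layer_one (hD : 1 ≤ D) (S : Finset (Vertex 1)) :
    DecodableWithRoot D S :=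
  (decodable_layer_one hD _).2 (Finset.mem_insert_self _ _)

end Code

/-! ### Missing paths, recovery and communicated fragments -/

section Paths

variable {n : ℕ}

/-- All vertices on the path from the root to `y` are missing. -/
def OpenPath (S : Finset (Vertex n)) (y : Leaf n) : Prop :=
  ∀ v : Vertex n, (v = y.1 ∨ y.1.StrictlyBelow v) → v ∉ S

theorem openPath_join (b r : Bool) (S T : Finset (Vertex n)) (y : Leaf n) :
    OpenPath (join b r S T) (Leaf.child b y) ↔ r = false ∧ OpenPath S y := by
  unfold OpenPath
  rw [forall_vertex_succ b]
  simp [Leaf.child]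

theorem openPath_layer_one (S : Finset (Vertex 1)) (y : Leaf 1) :
    OpenPath S y ↔ root 0 ∉ S := by
  rw [Leaf.eq_root y]
  unfold OpenPath
  constructor
  · exact fun h => h _ (Or.inl rfl)
  · intro h v _
    cases v with
    | root => exact h
    | child b w => exact isEmptyElim w

theorem missingPath_root_join (b r : Bool) (S T : Finset (Vertex n)) (y : Leaf n) :
    MissingPath (join b r S T) (root n) (Leaf.child b y).1 ↔ OpenPath S y := by
  unfold MissingPath OpenPath
  rw [forall_vertex_succ b]
  simp [Leaf.child]

theorem missingPath_child_join (b r : Bool) (S T : Finset (Vertex n)) (x : Vertex n)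
    (y : Leaf n) :
    MissingPath (join b r S T) (child b x) (Leaf.child b y).1 ↔ MissingPath S x y.1 := by
  unfold MissingPath
  rw [forall_vertex_succ b]
  simp [Leaf.child]

theorem not_missingPath_child_not (b : Bool) (U : Finset (Vertex (n + 1))) (x : Vertex n)
    (y : Leaf n) : ¬ MissingPath U (child (!b) x) (Leaf.child b y).1 := by
  unfold MissingPath
  simp [Leaf.child]

theorem recovers_root_join (b r : Bool) (S T : Finset (Vertex n)) (y : Leaf n) :
    Recovers (join b r S T) (root n) (Leaf.child b y) ↔ r = true ∧ OpenPath S y := by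
  rw [Recovers, missingPath_root_join, root_mem_join]

theorem recovers_child_join (b r : Bool) (S T : Finset (Vertex n)) (x : Vertex n)
    (y : Leaf n) :
    Recovers (join b r S T) (child b x) (Leaf.child b y) ↔ Recovers S x y := by
  rw [Recovers, missingPath_child_join, child_mem_join, Recovers]

theorem not_recovers_child_not (b : Bool) (U : Finset (Vertex (n + 1))) (x : Vertex n)
    (y : Leaf n) : ¬ Recovers U (child (!b) x) (Leaf.child b y) :=
  fun h => not_missingPath_child_not b U x y h.2

theorem not_recovers_layer_one (S : Finset (Vertex 1)) (x : Vertex 1) (y : Leaf 1) :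
    ¬ Recovers S x y := by
  rw [Leaf.eq_root y]
  exact fun h => (not_root_strictlyBelow _).1 h.2.1

theorem card_vertex_succ (b : Bool) (U : Finset (Vertex (n + 1))) (S T : Finset (Vertex n))
    (hr : root n ∉ U) (hS : ∀ v, child b v ∈ U ↔ v ∈ S) (hT : ∀ v, child (!b) v ∈ U ↔ v ∈ T) :
    U.card = S.card + T.card := by
  have hinj : ∀ c : Bool, Function.Injective (child c : Vertex n → Vertex (n + 1)) :=
    fun c v w h => by simpa using h
  have : U = S.map ⟨_, hinj b⟩ ∪ T.map ⟨_, hinj (!b)⟩ := by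
    rw [Finset.ext_iff, forall_vertex_succ b]
    simp [hr, hS, hT]
  rw [this, Finset.card_union_of_disjoint, Finset.card_map, Finset.card_map]
  rw [Finset.disjoint_left]
  simp

theorem card_topPresent_join_false (b : Bool) (S T : Finset (Vertex n)) :
    (topPresent (join b false S T)).card = (topPresent S).card + (topPresent T).card := by
  refine card_vertex_succ b _ _ _ ?_ ?_ ?_ <;>
  · simp only [topPresent, Finset.mem_filter, forall_vertex_succ b (n := n)]
    simp

theorem card_topPresent_join_true (b : Bool) (S T : Finset (Vertex n)) :
    (topPresent (join b true S T)).card = 1 := by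
  rw [Finset.card_eq_one]
  refine ⟨root n, ?_⟩
  rw [Finset.ext_iff, forall_vertex_succ b]
  simp only [topPresent, Finset.mem_filter, forall_vertex_succ b (n := n)]
  simp

/-- Only vertices strictly between the root and `z` can block `z`, so the state of the root plays no
role. -/
theorem card_reached_root_join (b r : Bool) (S T : Finset (Vertex n)) :
    (reached (join b r S T) (root n)).card = (topPresent S).card + (topPresent T).card := by
  refine card_vertex_succ b _ _ _ ?_ ?_ ?_ <;>
  · simp only [reached, topPresent, Finset.mem_filter, forall_vertex_succ b (n := n)]
    simp

theorem card_reached_child_join (b r : Bool) (S T : Finset (Vertex n)) (x : Vertex n) :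
    (reached (join b r S T) (child b x)).card = (reached S x).card := by
  rw [card_vertex_succ b _ (reached S x) ∅ ?_ ?_ ?_, Finset.card_empty, add_zero] <;>
  · simp only [reached, Finset.mem_filter, forall_vertex_succ b (n := n)]
    simp

theorem recoveredWith_join (b r : Bool) (S T : Finset (Vertex n)) (y : Leaf n) (N : ℕ) :
    RecoveredWith (join b r S T) (Leaf.child b y) N ↔ RecoveredWith S y N ∨
      (r = true ∧ OpenPath S y ∧ (topPresent S).card + (topPresent T).card = N) := by
  unfold RecoveredWith
  rw [exists_vertex_succ b]
  simp only [recovers_root_join, recovers_child_join, not_recovers_child_not,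
    card_reached_root_join, card_reached_child_join, false_and, exists_false, or_false]
  have : (Leaf.child b y).1 ∈ join b r S T ↔ y.1 ∈ S := child_mem_join b r S T y.1
  rw [this, and_assoc, or_assoc]
  exact or_congr_right or_comm

theorem recoveredWith_layer_one (S : Finset (Vertex 1)) (y : Leaf 1) (N : ℕ) :
    RecoveredWith S y N ↔ root 0 ∈ S ∧ N = 0 := by
  unfold RecoveredWith
  simp only [not_recovers_layer_one, false_and, exists_false, or_false]
  rw [Leaf.eq_root y]

theorem rootPath_join (b r : Bool) (S T : Finset (Vertex n)) (y : Leaf n) :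
    RootPath (join b r S T) (Leaf.child b y) ↔ r = true ∧ OpenPath S y := by
  unfold RootPath
  simp only [layer_eq_iff, exists_eq_left]
  rw [recovers_root_join]

theorem not_rootPath_layer_one (S : Finset (Vertex 1)) (y : Leaf 1) : ¬ RootPath S y :=
  fun ⟨_, _, h⟩ => not_recovers_layer_one _ _ _ h

theorem OpenPath.not_mem {S : Finset (Vertex n)} {y : Leaf n} (h : OpenPath S y) : y.1 ∉ S :=
  h _ (Or.inl rfl)

theorem OpenPath.not_recovers {S : Finset (Vertex n)} {y : Leaf n} (h : OpenPath S y)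
    (x : Vertex n) : ¬ Recovers S x y :=
  fun hx => h x (Or.inr hx.2.1) hx.1

theorem OpenPath.not_recoveredWith {S : Finset (Vertex n)} {y : Leaf n} (h : OpenPath S y)
    (N : ℕ) : ¬ RecoveredWith S y N := by
  rintro (⟨hy, -⟩ | ⟨x, hx, -⟩)
  · exact h.not_mem hy
  · exact h.not_recovers x hx

/-- On an open path the root is missing, so decodability would pass to the half containing `y`, and
finally to the missing leaf itself. -/
theorem OpenPath.not_decodable {D : ℕ} (hD : 1 ≤ D) : ∀ {n : ℕ} {S : Finset (Vertex (n + 1))}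
    {y : Leaf (n + 1)}, OpenPath S y → ¬ Decodable D S
  | 0, S, y, h => by
    rw [decodable_layer_one hD]
    exact (openPath_layer_one S y).1 h
  | n + 1, U, y, h => by
    obtain ⟨b, z, rfl⟩ := y.exists_eq_child
    obtain ⟨r, S, T, rfl⟩ := exists_eq_join b U
    rw [openPath_join] at h
    rw [h.1, decodable_join_false]
    exact fun hd => h.2.not_decodable hD hd.1

theorem Recovers.not_mem {U : Finset (Vertex n)} {x : Vertex n} {y : Leaf n}
    (h : Recovers U x y) : y.1 ∉ U := h.2.2 _ (Or.inl rfl) h.2.1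

/-- The recovering vertex is the lowest present ancestor of `y`. -/
theorem Recovers.unique : ∀ {n : ℕ} {U : Finset (Vertex (n + 1))} {x x' : Vertex (n + 1)}
    {y : Leaf (n + 1)}, Recovers U x y → Recovers U x' y → x = x'
  | 0, U, x, x', y, h, _ => absurd h (not_recovers_layer_one U x y)
  | n + 1, U, x, x', y, h, h' => by
    obtain ⟨b, z, rfl⟩ := y.exists_eq_child
    obtain ⟨r, S, T, rfl⟩ := exists_eq_join b U
    revert h h'
    revert x x'
    simp only [forall_vertex_succ b (n := n + 1), recovers_root_join, recovers_child_join,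
      not_recovers_child_not, IsEmpty.forall_iff, implies_true, and_true]
    refine ⟨⟨trivial, fun v h h' => ?_⟩, fun v => ⟨fun h h' => ?_, fun v' h h' => ?_⟩⟩
    · exact absurd h' (h.2.not_recovers v)
    · exact absurd h (h'.2.not_recovers v)
    · rw [h.unique h']

/-- The half of `y` has an open path and is not decodable, so the other half must be and contains no
open path. Both leaves therefore lie in the same half, which is decodable with its root. -/
theorem OpenPath.unique {D : ℕ} (hD : 1 ≤ D) : ∀ {n : ℕ} {U : Finset (Vertex (n + 1))}
    {y y' : Leaf (n + 1)}, DecodableWithRoot D U → OpenPath U y → OpenPath U y' → y = y'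
  | 0, U, y, y', _, _, _ => by rw [Leaf.eq_root y, Leaf.eq_root y']
  | n + 1, U, y, y', hU, h, h' => by
    obtain ⟨b, z, rfl⟩ := y.exists_eq_child
    obtain ⟨c, z', rfl⟩ := y'.exists_eq_child
    obtain ⟨r, S, T, rfl⟩ := exists_eq_join b U
    rw [decodableWithRoot_join, decodable_join_true hD] at hU
    rw [openPath_join] at h
    have hS := h.2.not_decodable hD
    have hU := hU.resolve_left fun h => hS h.1
    by_cases hc : c = b
    · subst hc
      rw [openPath_join] at h'
      rw [h.2.unique hD hU.1 h'.2]
    · have : b = !c := by cases b <;> cases c <;> simp_all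
      subst this
      rw [join_swap, openPath_join] at h'
      exact absurd hU.2 (h'.2.not_decodable hD)

theorem Recovers.leaf_unique {D : ℕ} (hD : 1 ≤ D) : ∀ {n : ℕ} {U : Finset (Vertex (n + 1))}
    {x : Vertex (n + 1)} {y y' : Leaf (n + 1)},
    DecodableWithRoot D U → Recovers U x y → Recovers U x y' → y = y'
  | 0, U, x, y, _, _, h, _ => absurd h (not_recovers_layer_one U x y)
  | n + 1, U, x, y, y', hU, h, h' => by
    obtain ⟨b, z, rfl⟩ := y.exists_eq_child
    obtain ⟨c, z', rfl⟩ := y'.exists_eq_child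
    obtain ⟨r, S, T, rfl⟩ := exists_eq_join b U
    rw [decodableWithRoot_join] at hU
    cases x with
    | root =>
      -- Deleting the root turns the leaves it recovers into ends of open paths and leaves the set
      -- decodable with its root.
      refine OpenPath.unique hD (U := join b false S T) ((decodableWithRoot_join _ _ _ _).2 hU)
        ((openPath_join _ _ _ _ _).2 ⟨rfl, ((recovers_root_join _ _ _ _ _).1 h).2⟩) ?_
      by_cases hc : c = b
      · subst hc
        exact (openPath_join _ _ _ _ _).2 ⟨rfl, ((recovers_root_join _ _ _ _ _).1 h').2⟩
      · have : b = !c := by cases b <;> cases c <;> simp_all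
        subst this
        rw [join_swap] at h' ⊢
        exact (openPath_join _ _ _ _ _).2 ⟨rfl, ((recovers_root_join _ _ _ _ _).1 h').2⟩
    | child a w =>
      have ha : a = b := h.2.1.1.symm
      have hc : c = a := h'.2.1.1
      subst ha hc
      rw [recovers_child_join] at h h'
      rw [decodable_join_true hD] at hU
      rw [h.leaf_unique hD (hU.elim (fun h => h.1.withRoot) fun h => h.1) h']

theorem mem_or_openPath_or_recovers : ∀ {n : ℕ} (U : Finset (Vertex (n + 1)))
    (y : Leaf (n + 1)), y.1 ∈ U ∨ OpenPath U y ∨ ∃ x, Recovers U x y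
  | 0, U, y => by
    rw [openPath_layer_one, Leaf.eq_root y]
    tauto
  | n + 1, U, y => by
    obtain ⟨b, z, rfl⟩ := y.exists_eq_child
    obtain ⟨r, S, T, rfl⟩ := exists_eq_join b U
    rw [exists_vertex_succ b]
    simp only [recovers_root_join, recovers_child_join, openPath_join]
    have := mem_or_openPath_or_recovers S z
    have hmem : (Leaf.child b z).1 ∈ join b r S T ↔ z.1 ∈ S := child_mem_join b r S T z.1
    rw [hmem]
    cases r <;> simp <;> tauto

open Classical in
/-- In a decodable set, every present vertex that recovers some leaf recovers exactly one, so that the total cost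
is the sum over the leaves of the costs of their recovery. -/
theorem totalCost_eq {D n : ℕ} (hD : 1 ≤ D) {U : Finset (Vertex (n + 1))} (hU : Decodable D U) :
    totalCost U = ∑ y : Leaf (n + 1), ∑ x : Vertex (n + 1),
      if Recovers U x y then (reached U x).card else 0 := by
  have hmem : ∀ x, x ∈ U.filter (fun x => ∃ y : Leaf (n + 1), Recovers U x y) ↔
      ∃ y : Leaf (n + 1), Recovers U x y := by
    intro x
    rw [Finset.mem_filter]
    exact ⟨fun h => h.2, fun h => ⟨h.choose_spec.1, h⟩⟩
  rw [totalCost, Finset.sum_comm]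
  refine Finset.sum_subset_zero_on_sdiff (Finset.subset_univ _) ?_ ?_
  · intro x hx
    rw [Finset.mem_sdiff, hmem] at hx
    exact Finset.sum_eq_zero fun y _ => if_neg fun h => hx.2 ⟨y, h⟩
  · intro x hx
    obtain ⟨y, hy⟩ := (hmem x).1 hx
    rw [Finset.sum_eq_single y, if_pos hy]
    · exact fun z _ hz => if_neg fun h => hz (h.leaf_unique hD hU.withRoot hy)
    · simp

open Classical in
theorem sum_recovers_eq {n : ℕ} (U : Finset (Vertex (n + 1))) (y : Leaf (n + 1)) (M : ℕ)
    (hM : Fintype.card (Vertex (n + 1)) < M) :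
    (∑ x : Vertex (n + 1), if Recovers U x y then (reached U x).card else 0) =
      ∑ N ∈ Finset.range M, if RecoveredWith U y N then N else 0 := by
  by_cases h : ∃ x, Recovers U x y
  · obtain ⟨x, hx⟩ := h
    have hrec : ∀ N, RecoveredWith U y N ↔ N = (reached U x).card := by
      intro N
      constructor
      · rintro (⟨hy, -⟩ | ⟨x', hx', rfl⟩)
        · exact absurd hy hx.not_mem
        · rw [hx.unique hx']
      · rintro rfl
        exact Or.inr ⟨x, hx, rfl⟩
    simp only [hrec]
    rw [Finset.sum_eq_single x (fun z _ hz => if_neg fun h => hz (h.unique hx)) (by simp),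
      if_pos hx, Finset.sum_ite_eq', if_pos]
    exact Finset.mem_range.2 ((Finset.card_le_univ _).trans_lt hM)
  · rw [Finset.sum_eq_zero fun x _ => if_neg fun hx => h ⟨x, hx⟩]
    refine (Finset.sum_eq_zero fun N _ => ?_).symm
    split_ifs with hN
    -- No vertex recovers `y`, so the leaf is present and `N = 0`.
    · exact hN.elim (fun h => h.2) fun ⟨x, hx, _⟩ => absurd ⟨x, hx⟩ h
    · rfl

theorem RecoveredWith.lt {n : ℕ} {U : Finset (Vertex (n + 1))} {y : Leaf (n + 1)} {N : ℕ}
    (h : RecoveredWith U y N) : N < Fintype.card (Vertex (n + 1)) + 1 := by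
  rcases h with ⟨-, rfl⟩ | ⟨x, -, rfl⟩
  · omega
  · exact Nat.lt_succ_of_le (Finset.card_le_univ _)

theorem card_topPresent_le : ∀ {n : ℕ} (U : Finset (Vertex (n + 1))),
    (topPresent U).card ≤ 2 ^ n
  | 0, U => by
    obtain ⟨r, S, T, rfl⟩ := exists_eq_join true U
    have hz : ∀ S : Finset (Vertex 0), S.card = 0 := fun S => by
      rw [Finset.card_eq_zero]
      exact Finset.eq_empty_of_isEmpty S
    cases r
    · rw [card_topPresent_join_false, hz, hz]; omega
    · rw [card_topPresent_join_true]; simp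
  | n + 1, U => by
    obtain ⟨r, S, T, rfl⟩ := exists_eq_join true U
    cases r
    · rw [card_topPresent_join_false, pow_succ]
      have := card_topPresent_le S
      have := card_topPresent_le T
      omega
    · rw [card_topPresent_join_true]
      exact Nat.one_le_two_pow

/-- This makes `F_i(0)` vanish, which is why the sums over `l` start at 1. -/
theorem Decodable.card_topPresent_pos {D : ℕ} (hD : 1 ≤ D) :
    ∀ {n : ℕ} {U : Finset (Vertex (n + 1))}, Decodable D U → 0 < (topPresent U).card
  | 0, U, h => by
    obtain ⟨r, S, T, rfl⟩ := exists_eq_join true U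
    rw [decodable_layer_one hD, root_mem_join] at h
    rw [h, card_topPresent_join_true]
    exact one_pos
  | n + 1, U, h => by
    obtain ⟨r, S, T, rfl⟩ := exists_eq_join true U
    cases r
    · rw [decodable_join_false] at h
      rw [card_topPresent_join_false]
      have := h.1.card_topPresent_pos hD
      omega
    · rw [card_topPresent_join_true]
      exact one_pos

end Paths

/-! ### Probabilities of random subsets and independence -/

section Prob

variable {n : ℕ}

theorem prob_congr {q : Vertex n → ℝ} {E F : Finset (Vertex n) → Prop}
    (h : ∀ S, E S ↔ F S) : prob q E = prob q F := by
  rw [funext fun S => propext (h S)]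

theorem prob_eq_zero {q : Vertex n → ℝ} {E : Finset (Vertex n) → Prop}
    (h : ∀ S, ¬ E S) : prob q E = 0 :=
  Finset.sum_eq_zero fun S _ => if_neg (h S)

theorem prob_split (q : Vertex n → ℝ) (E F : Finset (Vertex n) → Prop) :
    prob q E = prob q (fun S => F S ∧ E S) + prob q (fun S => ¬ F S ∧ E S) := by
  classical
  unfold prob
  rw [← Finset.sum_add_distrib]
  refine Finset.sum_congr rfl fun S _ => ?_
  by_cases hF : F S <;> simp [hF]

/-- Change of law without division, hence valid also when the conditioning event has probability
zero. -/
theorem prob_eq_mul {q q' : Vertex n → ℝ} {E : Finset (Vertex n) → Prop} {c : ℝ}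
    (h : ∀ S, E S → weight q S = c * weight q' S) : prob q E = c * prob q' E := by
  unfold prob
  rw [Finset.mul_sum]
  refine Finset.sum_congr rfl fun S _ => ?_
  split_ifs with hE
  · exact h S hE
  · rw [mul_zero]

open Classical in
/-- The probability of a relation between two independent random subsets. -/
noncomputable def pairProb {m : ℕ} (q : Vertex m → ℝ) (q' : Vertex n → ℝ)
    (E : Finset (Vertex m) → Finset (Vertex n) → Prop) : ℝ :=
  ∑ S : Finset (Vertex m), ∑ T : Finset (Vertex n), if E S T then weight q S * weight q' T else 0

theorem pairProb_congr {m : ℕ} {q : Vertex m → ℝ} {q' : Vertex n → ℝ}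
    {E F : Finset (Vertex m) → Finset (Vertex n) → Prop}
    (h : ∀ S T, E S T ↔ F S T) : pairProb q q' E = pairProb q q' F := by
  rw [funext fun S => funext fun T => propext (h S T)]

theorem pairProb_eq_zero {m : ℕ} {q : Vertex m → ℝ} {q' : Vertex n → ℝ}
    {E : Finset (Vertex m) → Finset (Vertex n) → Prop}
    (h : ∀ S T, ¬ E S T) : pairProb q q' E = 0 :=
  Finset.sum_eq_zero fun S _ => Finset.sum_eq_zero fun T _ => if_neg (h S T)

theorem pairProb_or {m : ℕ} {q : Vertex m → ℝ} {q' : Vertex n → ℝ}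
    {E F : Finset (Vertex m) → Finset (Vertex n) → Prop} (h : ∀ S T, E S T → ¬ F S T) :
    pairProb q q' (fun S T => E S T ∨ F S T) = pairProb q q' E + pairProb q q' F := by
  classical
  unfold pairProb
  rw [← Finset.sum_add_distrib]
  refine Finset.sum_congr rfl fun S _ => ?_
  rw [← Finset.sum_add_distrib]
  refine Finset.sum_congr rfl fun T _ => ?_
  by_cases hE : E S T
  · simp [hE, h S T hE]
  · simp [hE]

theorem pairProb_and {m : ℕ} (q : Vertex m → ℝ) (q' : Vertex n → ℝ)
    (E : Finset (Vertex m) → Prop) (F : Finset (Vertex n) → Prop) :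
    pairProb q q' (fun S T => E S ∧ F T) = prob q E * prob q' F := by
  classical
  unfold pairProb prob
  rw [Finset.sum_mul_sum]
  refine Finset.sum_congr rfl fun S _ => Finset.sum_congr rfl fun T _ => ?_
  by_cases hE : E S <;> by_cases hF : F T <;> simp [hE, hF]

/-- Independence turns the law of a sum into a convolution. On the range `l ≤ N`, so `N - l` is a
true difference. -/
theorem pairProb_add_eq {m : ℕ} (q : Vertex m → ℝ) (q' : Vertex n → ℝ)
    (E : Finset (Vertex m) → Prop) (F : Finset (Vertex n) → Prop)
    (f : Finset (Vertex m) → ℕ) (g : Finset (Vertex n) → ℕ) (N : ℕ) :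
    pairProb q q' (fun S T => E S ∧ F T ∧ f S + g T = N) =
      ∑ l ∈ Finset.range (N + 1),
        prob q' (fun T => F T ∧ g T = l) * prob q (fun S => E S ∧ f S = N - l) := by
  classical
  have : ∀ l, prob q' (fun T => F T ∧ g T = l) * prob q (fun S => E S ∧ f S = N - l) =
      ∑ S, ∑ T, if (E S ∧ f S = N - l) ∧ (F T ∧ g T = l) then weight q S * weight q' T else 0 := by
    intro l
    rw [mul_comm, ← pairProb_and]
    unfold pairProb
    refine Finset.sum_congr rfl fun S _ => Finset.sum_congr rfl fun T _ => ?_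
    congr
  rw [Finset.sum_congr rfl fun l _ => this l, Finset.sum_comm]
  unfold pairProb
  refine Finset.sum_congr rfl fun S _ => ?_
  rw [Finset.sum_comm]
  refine Finset.sum_congr rfl fun T _ => ?_
  by_cases h : E S ∧ F T ∧ f S + g T = N
  · rw [if_pos h, Finset.sum_eq_single (g T), if_pos]
    · exact ⟨⟨h.1, by omega⟩, h.2.1, rfl⟩
    · exact fun l _ hl => if_neg fun h' => hl h'.2.2.symm
    · exact fun hN => absurd (Finset.mem_range.2 (by omega)) hN
  · rw [if_neg h]
    refine (Finset.sum_eq_zero fun l hl => if_neg fun h' => h ⟨h'.1.1, h'.2.1, ?_⟩).symm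
    have := Finset.mem_range.1 hl
    have := h'.1.2
    have := h'.2.2
    omega

theorem prod_vertex_succ (b : Bool) (f : Vertex (n + 1) → ℝ) :
    ∏ v, f v = f (root n) * ((∏ v, f (child b v)) * ∏ v, f (child (!b) v)) := by
  rw [Fintype.prod_equiv (succEquiv n) f (fun o => f ((succEquiv n).symm o))
    (fun v => by rw [Equiv.symm_apply_apply]), Fintype.prod_option, Fintype.prod_prod_type,
    Fintype.prod_bool]
  cases b
  · rw [mul_comm (∏ v, f (child false v))]
    rfl
  · rfl

theorem weight_join (q : Vertex (n + 1) → ℝ) (b r : Bool) (S T : Finset (Vertex n)) :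
    weight q (join b r S T) = (if r then q (root n) else 1 - q (root n)) *
      (weight (fun v => q (child b v)) S * weight (fun v => q (child (!b) v)) T) := by
  unfold weight
  rw [prod_vertex_succ b]
  simp

/-- Conditioning on the root, from which every recursion starts. -/
theorem prob_join (q : Vertex (n + 1) → ℝ) (b : Bool) (E : Finset (Vertex (n + 1)) → Prop) :
    prob q E =
      q (root n) * pairProb (fun v => q (child b v)) (fun v => q (child (!b) v))
          (fun S T => E (join b true S T)) +
        (1 - q (root n)) * pairProb (fun v => q (child b v)) (fun v => q (child (!b) v))
          (fun S T => E (join b false S T)) := by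
  unfold prob pairProb
  rw [← (joinEquiv n b).sum_comp, Fintype.sum_prod_type, Fintype.sum_bool]
  simp only [Fintype.sum_prod_type, joinEquiv, Equiv.coe_fn_mk, weight_join, Finset.mul_sum,
    mul_ite, mul_zero, if_true, Bool.false_eq_true, if_false]
  rfl

open Classical in
theorem pairProb_layer_zero (q q' : Vertex 0 → ℝ)
    (E : Finset (Vertex 0) → Finset (Vertex 0) → Prop) :
    pairProb q q' E = if E ∅ ∅ then 1 else 0 := by
  unfold pairProb
  rw [Fintype.sum_subsingleton _ ∅, Fintype.sum_subsingleton _ ∅]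
  simp [weight]

theorem prob_true : ∀ {n : ℕ} (q : Vertex n → ℝ), prob q (fun _ => True) = 1
  | 0, q => by simp [prob, weight]
  | n + 1, q => by
    rw [prob_join q true]
    have := fun q q' : Vertex n → ℝ => pairProb_and q q' (fun _ => True) (fun _ => True)
    simp only [and_self] at this
    rw [this, prob_true, prob_true]
    ring

theorem prob_of_ae {q : Vertex n → ℝ} {E : Finset (Vertex n) → Prop}
    (h : ∀ S, ¬ E S → weight q S = 0) : prob q E = 1 := by
  rw [← prob_true q]
  unfold prob
  refine Finset.sum_congr rfl fun S _ => ?_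
  by_cases hE : E S
  · simp [hE]
  · simp [hE, h S hE]

end Prob

/-! ### The conditional laws along a path -/

section Laws

variable {n : ℕ} (p : ℕ → ℝ)

open Classical in
/-- The law in which all vertices on the path from the root to `y` are missing, and all other
vertices are included as before. -/
noncomputable def openPathProb (y : Leaf n) (v : Vertex n) : ℝ :=
  if v = y.1 ∨ y.1.StrictlyBelow v then 0 else p v.layer

theorem openPathProb_root (b : Bool) (y : Leaf n) :
    openPathProb p (Leaf.child b y) (root n) = 0 :=
  if_pos (Or.inr trivial)

theorem openPathProb_child (b : Bool) (y : Leaf n) :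
    (fun v => openPathProb p (Leaf.child b y) (child b v)) = openPathProb p y := by
  funext v
  have : (child b v = (Leaf.child b y).1 ∨ (Leaf.child b y).1.StrictlyBelow (child b v)) ↔
      (v = y.1 ∨ y.1.StrictlyBelow v) := by simp [Leaf.child]
  by_cases h : v = y.1 ∨ y.1.StrictlyBelow v
  · exact (if_pos (this.2 h)).trans (if_pos h).symm
  · exact (if_neg (this.not.2 h)).trans (if_neg h).symm

theorem openPathProb_child_not (b : Bool) (y : Leaf n) :
    (fun v => openPathProb p (Leaf.child b y) (child (!b) v)) = layerProb p n := by
  funext v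
  simp [openPathProb, Leaf.child, layerProb]

theorem openPathProb_layer_one (y : Leaf 1) : openPathProb p y (root 0) = 0 := by
  rw [Leaf.eq_root y]
  exact if_pos (Or.inl rfl)

theorem rootPathProb_root (y : Leaf (n + 1)) : rootPathProb p y (root n) = 1 :=
  if_pos rfl

theorem rootPathProb_child (b : Bool) (y : Leaf n) :
    (fun v => rootPathProb p (Leaf.child b y) (child b v)) = openPathProb p y := by
  funext v
  have := layer_le v
  rw [← openPathProb_child p b y]
  exact if_neg (by rw [layer_child]; omega)

theorem rootPathProb_child_not (b : Bool) (y : Leaf n) :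
    (fun v => rootPathProb p (Leaf.child b y) (child (!b) v)) = layerProb p n := by
  funext v
  have := layer_le v
  rw [← openPathProb_child_not p b y]
  exact if_neg (by rw [layer_child]; omega)

theorem layerProb_root : layerProb p (n + 1) (root n) = p (n + 1) := rfl

theorem layerProb_child (b : Bool) :
    (fun v => layerProb p (n + 1) (child b v)) = layerProb p n := rfl

theorem weight_openPathProb_eq_zero (y : Leaf n) {S : Finset (Vertex n)} (h : ¬ OpenPath S y) :
    weight (openPathProb p y) S = 0 := by
  unfold OpenPath at h
  push Not at h
  obtain ⟨v, hv, hvS⟩ := h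
  refine Finset.prod_eq_zero (Finset.mem_univ v) ?_
  rw [if_pos hvS]
  exact if_pos hv

/-- The path meets every layer once, so the two weights differ by one factor `1 - p l` per layer. -/
theorem weight_eq_of_openPath : ∀ {n : ℕ} {U : Finset (Vertex (n + 1))} {y : Leaf (n + 1)},
    OpenPath U y → weight (layerProb p (n + 1)) U =
      (∏ l ∈ Finset.Icc 1 (n + 1), (1 - p l)) * weight (openPathProb p y) U
  | 0, U, y, h => by
    obtain ⟨r, S, T, rfl⟩ := exists_eq_join true U
    rw [openPath_layer_one, root_mem_join] at h
    rw [weight_join, weight_join, openPathProb_layer_one, layerProb_root]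
    simp [weight, h]
  | n + 1, U, y, h => by
    obtain ⟨b, z, rfl⟩ := y.exists_eq_child
    obtain ⟨r, S, T, rfl⟩ := exists_eq_join b U
    rw [openPath_join] at h
    rw [weight_join, weight_join, layerProb_child, layerProb_child, openPathProb_child,
      openPathProb_child_not, openPathProb_root, layerProb_root, h.1, weight_eq_of_openPath h.2,
      Finset.prod_Icc_succ_top (by omega : 1 ≤ n + 1 + 1)]
    simp only [Bool.false_eq_true, if_false]
    ring

theorem weight_eq_of_rootPath {U : Finset (Vertex (n + 2))} {y : Leaf (n + 2)}
    (h : RootPath U y) : weight (layerProb p (n + 2)) U =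
      (p (n + 2) * ∏ l ∈ Finset.Icc 1 (n + 1), (1 - p l)) * weight (rootPathProb p y) U := by
  obtain ⟨b, z, rfl⟩ := y.exists_eq_child
  obtain ⟨r, S, T, rfl⟩ := exists_eq_join b U
  rw [rootPath_join] at h
  rw [weight_join, weight_join, layerProb_child, layerProb_child, rootPathProb_child,
    rootPathProb_child_not, rootPathProb_root, layerProb_root, h.1,
    weight_eq_of_openPath p h.2]
  simp only [if_true]
  ring

theorem weight_rootPathProb_eq_zero {U : Finset (Vertex (n + 2))} {y : Leaf (n + 2)}
    (h : ¬ RootPath U y) : weight (rootPathProb p y) U = 0 := by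
  obtain ⟨b, z, rfl⟩ := y.exists_eq_child
  obtain ⟨r, S, T, rfl⟩ := exists_eq_join b U
  rw [rootPath_join] at h
  rw [weight_join, rootPathProb_child, rootPathProb_root]
  cases r
  · simp
  · rw [weight_openPathProb_eq_zero p z fun hz => h ⟨rfl, hz⟩]
    ring

end Laws

/-! ### The recursions -/

section Recursion

variable {D n : ℕ} (p : ℕ → ℝ)

/-- The probability that a subset of `T_{n+1}` is not decodable, but becomes decodable once the
fragment of the root is known. -/
noncomputable def rootNeededProb (D : ℕ) (p : ℕ → ℝ) (n : ℕ) : ℝ :=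
  prob (layerProb p (n + 1)) (fun S => DecodableWithRoot D S ∧ ¬ Decodable D S)

/-- The probability that a subset of `T_{n+1}` is not decodable, but becomes decodable once the
fragment of the root is known, and that `y` is recovered with `N` communicated fragments. -/
noncomputable def rootNeededJointProb (D : ℕ) (p : ℕ → ℝ) (n : ℕ) (y : Leaf (n + 1)) (N : ℕ) : ℝ :=
  prob (layerProb p (n + 1))
    (fun S => (DecodableWithRoot D S ∧ ¬ Decodable D S) ∧ RecoveredWith S y N)

/-- The probability, when the path from the root to `y` is missing, that the subset of `T_{n+1}`
becomes decodable once the fragment of the root is known, and that `N` present vertices have no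
present ancestor. -/
noncomputable def openTopProb (D : ℕ) (p : ℕ → ℝ) (n : ℕ) (y : Leaf (n + 1)) (N : ℕ) : ℝ :=
  prob (openPathProb p y)
    (fun S => (OpenPath S y ∧ DecodableWithRoot D S) ∧ (topPresent S).card = N)

/-- The alternatives are now mutually exclusive, so their probabilities add. -/
theorem decodable_join_true_iff (hD : 1 ≤ D) (b : Bool) (S T : Finset (Vertex (n + 1))) :
    Decodable D (join b true S T) ↔ (Decodable D S ∧ Decodable D T) ∨
      (Decodable D S ∧ DecodableWithRoot D T ∧ ¬ Decodable D T) ∨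
      ((DecodableWithRoot D S ∧ ¬ Decodable D S) ∧ Decodable D T) := by
  rw [decodable_join_true hD]
  have hS := Decodable.withRoot (D := D) (S := S)
  have hT := Decodable.withRoot (D := D) (S := T)
  tauto

theorem rootNeeded_join (hD : 1 ≤ D) (b r : Bool) (S T : Finset (Vertex (n + 1))) :
    DecodableWithRoot D (join b r S T) ∧ ¬ Decodable D (join b r S T) ↔
      r = false ∧ ((Decodable D S ∧ DecodableWithRoot D T ∧ ¬ Decodable D T) ∨
      ((DecodableWithRoot D S ∧ ¬ Decodable D S) ∧ Decodable D T)) := by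
  rw [decodableWithRoot_join]
  cases r
  · rw [decodable_join_true_iff hD, decodable_join_false]
    tauto
  · simp

theorem prob_layer_one (q : Vertex 1 → ℝ) (c : Prop) [Decidable c]
    {E : Finset (Vertex 1) → Prop} (hE : ∀ U, E U ↔ root 0 ∈ U ∧ c) :
    prob q E = if c then q (root 0) else 0 := by
  rw [prob_join q true, pairProb_layer_zero, pairProb_layer_zero]
  simp only [hE, root_mem_join]
  by_cases hc : c <;> simp [hc]

theorem card_topPresent_layer_one (U : Finset (Vertex 1)) :
    root 0 ∈ U → (topPresent U).card = 1 := by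
  obtain ⟨r, S, T, rfl⟩ := exists_eq_join true U
  rw [root_mem_join]
  rintro rfl
  exact card_topPresent_join_true _ _ _

theorem topProb_one (hD : 1 ≤ D) (N : ℕ) : topProb D p 1 N = if N = 1 then p 1 else 0 := by
  refine prob_layer_one _ _ fun U => ?_
  rw [decodable_layer_one hD]
  refine and_congr_right fun h => ?_
  rw [card_topPresent_layer_one U h, eq_comm]

theorem jointProb_one (hD : 1 ≤ D) (y : Leaf 1) (N : ℕ) :
    jointProb D p 1 y N = if N = 0 then p 1 else 0 := by
  refine prob_layer_one _ _ fun U => ?_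
  rw [decodable_layer_one hD, recoveredWith_layer_one]
  tauto

theorem rootNeededProb_zero (hD : 1 ≤ D) : rootNeededProb D p 0 = 1 - p 1 := by
  unfold rootNeededProb
  rw [prob_join _ true, pairProb_layer_zero, pairProb_layer_zero]
  simp [decodable_layer_one hD, decodableWithRoot_layer_one hD, layerProb_root]

theorem rootNeededJointProb_zero (hD : 1 ≤ D) (y : Leaf 1) (N : ℕ) :
    rootNeededJointProb D p 0 y N = 0 := by
  refine prob_eq_zero fun S => ?_
  rw [decodable_layer_one hD, recoveredWith_layer_one]
  tauto

theorem openTopProb_zero (hD : 1 ≤ D) (y : Leaf 1) (N : ℕ) :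
    openTopProb D p 0 y N = if N = 0 then 1 else 0 := by
  have hz : ∀ S : Finset (Vertex 0), S.card = 0 := fun S => by
    rw [Finset.card_eq_zero]
    exact Finset.eq_empty_of_isEmpty S
  unfold openTopProb
  rw [prob_join _ true, pairProb_layer_zero, pairProb_layer_zero, openPathProb_layer_one]
  simp [decodableWithRoot_layer_one hD, openPath_layer_one, card_topPresent_join_false, hz,
    eq_comm]

theorem rootCondProb_one (y : Leaf 1) (N : ℕ) : rootCondProb D p 1 y N = 0 :=
  prob_eq_zero fun _ h => not_rootPath_layer_one _ _ h.1

theorem topProb_eq_zero_of_lt {l : ℕ} (hl : 2 ^ n < l) : topProb D p (n + 1) l = 0 :=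
  prob_eq_zero fun S h => by
    have := card_topPresent_le S
    omega

theorem topProb_zero_right (hD : 1 ≤ D) : topProb D p (n + 1) 0 = 0 :=
  prob_eq_zero fun S h => by
    have := h.1.card_topPresent_pos hD
    omega

/-- `F` vanishes at 0 and above the number of leaves. The filter `l ≤ N` encodes the convention that
`A` is zero at negative arguments; truncated subtraction alone would give its value at 0. -/
theorem topProb_convolution (hD : 1 ≤ D) (f : ℕ → ℝ) (N : ℕ) :
    ∑ l ∈ Finset.range (N + 1), topProb D p (n + 1) l * f (N - l) =
      ∑ l ∈ (Finset.Icc 1 (2 ^ n)).filter (fun l => l ≤ N),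
        topProb D p (n + 1) l * f (N - l) := by
  refine (Finset.sum_subset (fun l hl => ?_) fun l hl hl' => ?_).symm
  · rw [Finset.mem_filter] at hl
    exact Finset.mem_range.2 (by omega)
  · rw [Finset.mem_range] at hl
    rw [Finset.mem_filter, Finset.mem_Icc] at hl'
    rcases Nat.eq_zero_or_pos l with rfl | h0
    · rw [topProb_zero_right p hD, zero_mul]
    · rw [topProb_eq_zero_of_lt p (by omega), zero_mul]

theorem openTop_event (hD : 1 ≤ D) (b : Bool) (S T : Finset (Vertex (n + 1)))
    (y : Leaf (n + 1)) : OpenPath S y ∧ Decodable D (join b true S T) ↔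
      (OpenPath S y ∧ DecodableWithRoot D S) ∧ Decodable D T := by
  rw [decodable_join_true hD, and_assoc]
  refine and_congr_right fun h => or_iff_right fun h' => h.not_decodable hD h'.1

theorem openTopProb_succ (hD : 1 ≤ D) (b : Bool) (y : Leaf (n + 1)) (N : ℕ) :
    openTopProb D p (n + 1) (Leaf.child b y) N =
      ∑ l ∈ Finset.range (N + 1), topProb D p (n + 1) l * openTopProb D p n y (N - l) := by
  unfold openTopProb topProb
  rw [prob_join _ b, openPathProb_child, openPathProb_child_not, openPathProb_root, zero_mul,
    zero_add, sub_zero, one_mul, ← pairProb_add_eq]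
  refine pairProb_congr fun S T => ?_
  rw [openPath_join, decodableWithRoot_join, card_topPresent_join_false, ← and_assoc,
    ← openTop_event hD b]
  simp

/-- The right-hand side is that of `openTopProb_succ`: a missing root with known fragment behaves
like a present root. This identity closes the recursion for `A`. -/
theorem rootCondProb_succ (hD : 1 ≤ D) (b : Bool) (y : Leaf (n + 1)) (N : ℕ) :
    rootCondProb D p (n + 2) (Leaf.child b y) N =
      ∑ l ∈ Finset.range (N + 1), topProb D p (n + 1) l * openTopProb D p n y (N - l) := by
  unfold openTopProb topProb rootCondProb
  rw [prob_join _ b, rootPathProb_child, rootPathProb_child_not, rootPathProb_root, sub_self,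
    zero_mul, add_zero, one_mul, ← pairProb_add_eq]
  refine pairProb_congr fun S T => ?_
  rw [rootPath_join, recoveredWith_join]
  have := openTop_event hD b S T y
  have := fun h : OpenPath S y => h.not_recoveredWith N
  tauto

theorem pairProb_decodable_join_true (hD : 1 ≤ D) (b : Bool) :
    pairProb (layerProb p (n + 1)) (layerProb p (n + 1))
        (fun S T => Decodable D (join b true S T)) =
      decodableProb D p (n + 1) ^ 2 +
        2 * (decodableProb D p (n + 1) * rootNeededProb D p n) := by
  simp only [decodable_join_true_iff hD]
  rw [pairProb_or (by tauto), pairProb_or (by tauto), pairProb_and, pairProb_and, pairProb_and]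
  unfold decodableProb rootNeededProb
  ring

theorem rootNeededProb_succ (hD : 1 ≤ D) :
    rootNeededProb D p (n + 1) =
      (1 - p (n + 2)) * (2 * (decodableProb D p (n + 1) * rootNeededProb D p n)) := by
  rw [rootNeededProb, prob_join _ true]
  simp only [rootNeeded_join hD]
  rw [pairProb_eq_zero (by simp), mul_zero, zero_add]
  simp only [true_and]
  rw [pairProb_or (by tauto), layerProb_child, layerProb_child, pairProb_and, pairProb_and,
    layerProb_root]
  unfold decodableProb rootNeededProb
  ring

/-- There are `2 ^ n` ends for the unique missing path; its vertices give the factors `1 - p l`, and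
the decodable subtrees hanging off it the factors `Q`. -/
theorem rootNeededProb_eq (hD : 1 ≤ D) : ∀ n : ℕ,
    rootNeededProb D p n = 2 ^ n * ((∏ l ∈ Finset.Icc 1 (n + 1), (1 - p l)) *
      ∏ l ∈ Finset.Icc 1 n, decodableProb D p l)
  | 0 => by rw [rootNeededProb_zero p hD]; simp
  | n + 1 => by
    rw [rootNeededProb_succ p hD, rootNeededProb_eq hD n,
      Finset.prod_Icc_succ_top (by omega : 1 ≤ n + 1 + 1),
      Finset.prod_Icc_succ_top (by omega : 1 ≤ n + 1) (decodableProb D p)]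
    ring

theorem rootNeededJointProb_succ (hD : 1 ≤ D) (b : Bool) (y : Leaf (n + 1)) (N : ℕ) :
    rootNeededJointProb D p (n + 1) (Leaf.child b y) N =
      (1 - p (n + 2)) * (jointProb D p (n + 1) y N * rootNeededProb D p n +
        rootNeededJointProb D p n y N * decodableProb D p (n + 1)) := by
  rw [rootNeededJointProb, prob_join _ b]
  simp only [rootNeeded_join hD, recoveredWith_join]
  rw [pairProb_eq_zero (by simp), mul_zero, zero_add, layerProb_child, layerProb_child,
    layerProb_root]
  unfold decodableProb rootNeededProb rootNeededJointProb jointProb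
  rw [← pairProb_and, ← pairProb_and, ← pairProb_or (by tauto)]
  congr 1
  refine pairProb_congr fun S T => ?_
  simp only [true_and, Bool.false_eq_true, false_and, or_false]
  tauto

/-- Unless the root recovers `y`, the recovery of `y` and its cost are decided in the half of `y`,
and the root matters only for decodability. If both halves are decodable the root is free, and its
two probabilities add up to 1; if one half needs its root fragment, the root must be present. -/
theorem jointProb_succ (hD : 1 ≤ D) (b : Bool) (y : Leaf (n + 1)) (N : ℕ) :
    jointProb D p (n + 2) (Leaf.child b y) N =
      decodableProb D p (n + 1) * jointProb D p (n + 1) y N +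
      rootCondProb D p (n + 2) (Leaf.child b y) N * p (n + 2) *
        ∏ l ∈ Finset.Icc 1 (n + 1), (1 - p l) +
      p (n + 2) * (jointProb D p (n + 1) y N * rootNeededProb D p n +
        rootNeededJointProb D p n y N * decodableProb D p (n + 1)) := by
  rw [jointProb, prob_split _ _ (fun U => RootPath U (Leaf.child b y)),
    prob_eq_mul (fun U h => weight_eq_of_rootPath p h.1), ← rootCondProb, prob_join _ b,
    layerProb_child, layerProb_child, layerProb_root]
  have htrue : pairProb (layerProb p (n + 1)) (layerProb p (n + 1))
      (fun S T => ¬ RootPath (join b true S T) (Leaf.child b y) ∧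
        Decodable D (join b true S T) ∧
          RecoveredWith (join b true S T) (Leaf.child b y) N) =
      jointProb D p (n + 1) y N * decodableProb D p (n + 1) +
        (jointProb D p (n + 1) y N * rootNeededProb D p n +
        rootNeededJointProb D p n y N * decodableProb D p (n + 1)) := by
    unfold decodableProb rootNeededProb rootNeededJointProb jointProb
    rw [← pairProb_and, ← pairProb_and, ← pairProb_and, ← pairProb_or (by tauto),
      ← pairProb_or (by tauto)]
    refine pairProb_congr fun S T => ?_
    rw [rootPath_join, recoveredWith_join, decodable_join_true_iff hD]
    have := fun h : OpenPath S y => h.not_recoveredWith N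
    tauto
  have hfalse : pairProb (layerProb p (n + 1)) (layerProb p (n + 1))
      (fun S T => ¬ RootPath (join b false S T) (Leaf.child b y) ∧
        Decodable D (join b false S T) ∧
          RecoveredWith (join b false S T) (Leaf.child b y) N) =
      jointProb D p (n + 1) y N * decodableProb D p (n + 1) := by
    unfold decodableProb jointProb
    rw [← pairProb_and]
    refine pairProb_congr fun S T => ?_
    rw [rootPath_join, recoveredWith_join, decodable_join_false]
    simp only [Bool.false_eq_true, false_and, or_false, not_false_eq_true, true_and]
    tauto
  rw [htrue, hfalse]
  ring

theorem topProb_succ {N : ℕ} (hN : 1 < N) :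
    topProb D p (n + 2) N = (1 - p (n + 2)) *
      ∑ l ∈ Finset.range (N + 1), topProb D p (n + 1) l * topProb D p (n + 1) (N - l) := by
  unfold topProb
  rw [prob_join _ true, layerProb_child, layerProb_child, layerProb_root, pairProb_eq_zero,
    mul_zero, zero_add, ← pairProb_add_eq]
  · congr 1
    refine pairProb_congr fun S T => ?_
    rw [decodable_join_false, card_topPresent_join_false, and_assoc]
  · intro S T h
    rw [card_topPresent_join_true] at h
    omega

theorem topProb_succ_one (hD : 1 ≤ D) :
    topProb D p (n + 2) 1 = p (n + 2) * (decodableProb D p (n + 1) ^ 2 +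
      2 * (decodableProb D p (n + 1) * rootNeededProb D p n)) := by
  unfold topProb
  rw [prob_join _ true, layerProb_child, layerProb_child, layerProb_root,
    pairProb_eq_zero (E := fun S T => Decodable D (join true false S T) ∧ _), mul_zero, add_zero,
    ← pairProb_decodable_join_true p hD true]
  · congr 1
    refine pairProb_congr fun S T => ?_
    rw [card_topPresent_join_true]
    simp
  -- With the root missing, each decodable half contributes at least one top vertex, so the count is
  -- at least two.
  · rintro S T ⟨h₁, h₂⟩
    rw [decodable_join_false] at h₁
    rw [card_topPresent_join_false] at h₂
    have := h₁.1.card_topPresent_pos hD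
    have := h₁.2.card_topPresent_pos hD
    omega

/-- The recursions do not mention the side `b`, but they feed one another, so the four quantities go
through one induction. -/
theorem probs_eq_of_leaf (hD : 1 ≤ D) : ∀ {n : ℕ} (y z : Leaf (n + 1)) (N : ℕ),
    jointProb D p (n + 1) y N = jointProb D p (n + 1) z N ∧
      rootNeededJointProb D p n y N = rootNeededJointProb D p n z N ∧
      openTopProb D p n y N = openTopProb D p n z N ∧
      rootCondProb D p (n + 1) y N = rootCondProb D p (n + 1) z N
  | 0, y, z, N => by rw [Leaf.eq_root y, Leaf.eq_root z]; simp
  | n + 1, y, z, N => by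
    obtain ⟨b, y, rfl⟩ := y.exists_eq_child
    obtain ⟨c, z, rfl⟩ := z.exists_eq_child
    have ho : ∀ N, openTopProb D p n y N = openTopProb D p n z N :=
      fun N => (probs_eq_of_leaf hD y z N).2.2.1
    obtain ⟨h₁, h₂, -, -⟩ := probs_eq_of_leaf hD y z N
    have hA : rootCondProb D p (n + 2) (Leaf.child b y) N =
        rootCondProb D p (n + 2) (Leaf.child c z) N := by
      rw [rootCondProb_succ p hD, rootCondProb_succ p hD]
      simp only [ho]
    refine ⟨?_, ?_, ?_, hA⟩
    · rw [jointProb_succ p hD, jointProb_succ p hD, h₁, h₂, hA]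
    · rw [rootNeededJointProb_succ p hD, rootNeededJointProb_succ p hD, h₁, h₂]
    · rw [openTopProb_succ p hD, openTopProb_succ p hD]
      simp only [ho]

/-- The leftmost leaf. -/
def leftLeaf : (n : ℕ) → Leaf (n + 1)
  | 0 => ⟨root 0, rfl⟩
  | n + 1 => Leaf.child false (leftLeaf n)

/-- `P_i(N)`, computed for the leftmost leaf. -/
noncomputable def leafJointProb (D : ℕ) (p : ℕ → ℝ) : ℕ → ℕ → ℝ
  | 0, _ => 0
  | n + 1, N => jointProb D p (n + 1) (leftLeaf n) N

/-- `A_i(N)`, computed for the leftmost leaf. -/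
noncomputable def leafRootCondProb (D : ℕ) (p : ℕ → ℝ) : ℕ → ℕ → ℝ
  | 0, _ => 0
  | n + 1, N => rootCondProb D p (n + 1) (leftLeaf n) N

theorem jointProb_eq (hD : 1 ≤ D) : ∀ {n : ℕ} (y : Leaf n) (N : ℕ),
    jointProb D p n y N = leafJointProb D p n N
  | 0, y, _ => isEmptyElim y.1
  | _ + 1, y, N => (probs_eq_of_leaf p hD y _ N).1

theorem rootCondProb_eq (hD : 1 ≤ D) : ∀ {n : ℕ} (y : Leaf n) (N : ℕ),
    rootCondProb D p n y N = leafRootCondProb D p n N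
  | 0, y, _ => isEmptyElim y.1
  | _ + 1, y, N => (probs_eq_of_leaf p hD y _ N).2.2.2

/-- Numerator and denominator acquire the same factor under the change of law, and `rootPathProb` is
concentrated on the conditioning event. -/
theorem leafRootCondProb_eq_div (hD : 1 ≤ D) {n : ℕ} (y : Leaf n) (N : ℕ)
    (h : 0 < prob (layerProb p n) (fun S => RootPath S y)) :
    leafRootCondProb D p n N =
      prob (layerProb p n) (fun S => (Decodable D S ∧ RecoveredWith S y N) ∧ RootPath S y) /
        prob (layerProb p n) (fun S => RootPath S y) := by
  match n, y, h with
  | 0, y, _ => exact isEmptyElim y.1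
  | 1, y, h =>
    rw [prob_eq_zero fun S => not_rootPath_layer_one S y] at h
    exact absurd h (lt_irrefl _)
  | n + 2, y, h =>
    have hden : prob (layerProb p (n + 2)) (fun S => RootPath S y) =
        p (n + 2) * ∏ l ∈ Finset.Icc 1 (n + 1), (1 - p l) := by
      rw [prob_eq_mul (fun U h => weight_eq_of_rootPath p h),
        prob_of_ae (fun U h => weight_rootPathProb_eq_zero p h), mul_one]
    rw [prob_eq_mul (fun U h => weight_eq_of_rootPath p h.2), ← hden, mul_div_cancel_left₀ _ h.ne',
      ← rootCondProb_eq p hD y, rootCondProb]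
    exact prob_congr fun S => by tauto

theorem sum_erase_succ (N : ℕ) :
    ∑ j ∈ Finset.Icc 1 (n + 1), 2 ^ (j - 1) * leafJointProb D p j N *
        ∏ l ∈ (Finset.Icc 1 (n + 1)).erase j, decodableProb D p l =
      (∑ j ∈ Finset.Icc 1 n, 2 ^ (j - 1) * leafJointProb D p j N *
        ∏ l ∈ (Finset.Icc 1 n).erase j, decodableProb D p l) * decodableProb D p (n + 1) +
      2 ^ n * leafJointProb D p (n + 1) N * ∏ l ∈ Finset.Icc 1 n, decodableProb D p l := by
  have hlast : (Finset.Icc 1 (n + 1)).erase (n + 1) = Finset.Icc 1 n := by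
    ext l
    simp only [Finset.mem_erase, Finset.mem_Icc]
    omega
  rw [Finset.sum_Icc_succ_top (by omega : 1 ≤ n + 1), hlast, Nat.add_sub_cancel, Finset.sum_mul]
  congr 1
  refine Finset.sum_congr rfl fun j hj => ?_
  rw [Finset.mem_Icc] at hj
  have : (Finset.Icc 1 (n + 1)).erase j = insert (n + 1) ((Finset.Icc 1 n).erase j) := by
    ext l
    simp only [Finset.mem_erase, Finset.mem_Icc, Finset.mem_insert]
    omega
  rw [this, Finset.prod_insert (by simp)]
  ring

/-- Here `j` is the height of the subtree off the missing path that contains `y`. The path ends in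
the sibling of that subtree, at one of `2 ^ (j - 1)` leaves; the other hanging subtrees are merely
decodable. -/
theorem rootNeededJointProb_eq (hD : 1 ≤ D) (N : ℕ) : ∀ {n : ℕ} (y : Leaf (n + 1)),
    rootNeededJointProb D p n y N = (∏ l ∈ Finset.Icc 1 (n + 1), (1 - p l)) *
      ∑ j ∈ Finset.Icc 1 n, 2 ^ (j - 1) * leafJointProb D p j N *
        ∏ l ∈ (Finset.Icc 1 n).erase j, decodableProb D p l
  | 0, y => by rw [rootNeededJointProb_zero p hD]; simp
  | n + 1, y => by
    obtain ⟨b, y, rfl⟩ := y.exists_eq_child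
    rw [rootNeededJointProb_succ p hD, rootNeededJointProb_eq hD N y, rootNeededProb_eq p hD,
      jointProb_eq p hD, sum_erase_succ, Finset.prod_Icc_succ_top (by omega : 1 ≤ n + 1 + 1)]
    ring

/-- The recursion for `P`. -/
theorem leafJointProb_succ (hD : 1 ≤ D) (n N : ℕ) :
    leafJointProb D p (n + 2) N =
      decodableProb D p (n + 1) * leafJointProb D p (n + 1) N +
      leafRootCondProb D p (n + 2) N * p (n + 2) * ∏ l ∈ Finset.Icc 1 (n + 1), (1 - p l) +
      p (n + 2) * (∏ l ∈ Finset.Icc 1 (n + 1), (1 - p l)) *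
        ∑ j ∈ Finset.Icc 1 (n + 1), 2 ^ (j - 1) * leafJointProb D p j N *
          ∏ l ∈ (Finset.Icc 1 (n + 1)).erase j, decodableProb D p l := by
  rw [← jointProb_eq p hD (Leaf.child false (leftLeaf n)), jointProb_succ p hD,
    rootCondProb_eq p hD, rootNeededJointProb_eq p hD, rootNeededProb_eq p hD, jointProb_eq p hD,
    sum_erase_succ]
  ring

/-- The recursion for `A`. -/
theorem leafRootCondProb_succ (hD : 1 ≤ D) (n N : ℕ) :
    leafRootCondProb D p (n + 3) N =
      ∑ l ∈ (Finset.Icc 1 (2 ^ (n + 1))).filter (fun l => l ≤ N),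
        topProb D p (n + 2) l * leafRootCondProb D p (n + 2) (N - l) := by
  rw [← topProb_convolution p hD, ← rootCondProb_eq p hD (Leaf.child false (leftLeaf (n + 1))),
    rootCondProb_succ p hD]
  refine Finset.sum_congr rfl fun l _ => ?_
  rw [← rootCondProb_eq p hD (Leaf.child false (leftLeaf n)), rootCondProb_succ p hD, leftLeaf,
    openTopProb_succ p hD]

theorem leafRootCondProb_two (hD : 1 ≤ D) (N : ℕ) :
    leafRootCondProb D p 2 N = if N = 1 then p 1 else 0 := by
  rw [← rootCondProb_eq p hD (Leaf.child false (leftLeaf 0)), rootCondProb_succ p hD,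
    Finset.sum_eq_single N, Nat.sub_self, openTopProb_zero p hD, if_pos rfl, mul_one,
    topProb_one p hD]
  · intro l hl hlN
    rw [Finset.mem_range] at hl
    rw [openTopProb_zero p hD, if_neg (by omega), mul_zero]
  · simp

/-- The recursion for `F`. -/
theorem topProb_succ_Icc (hD : 1 ≤ D) {N : ℕ} (hN : 1 < N) :
    topProb D p (n + 2) N = (1 - p (n + 2)) *
      ∑ l ∈ Finset.Icc 1 (N - 1), topProb D p (n + 1) l * topProb D p (n + 1) (N - l) := by
  rw [topProb_succ p hN]
  congr 1
  refine (Finset.sum_subset (fun l hl => ?_) fun l hl hl' => ?_).symm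
  · rw [Finset.mem_Icc] at hl
    exact Finset.mem_range.2 (by omega)
  · rw [Finset.mem_range] at hl
    rw [Finset.mem_Icc] at hl'
    obtain rfl | rfl : l = 0 ∨ l = N := by omega
    · rw [topProb_zero_right p hD, zero_mul]
    · rw [Nat.sub_self, topProb_zero_right p hD, mul_zero]

theorem topProb_succ_one_prod (hD : 1 ≤ D) :
    topProb D p (n + 2) 1 = p (n + 2) * (decodableProb D p (n + 1) ^ 2 +
      2 ^ (n + 1) * ∏ j ∈ Finset.Icc 1 (n + 1), ((1 - p j) * decodableProb D p j)) := by
  rw [topProb_succ_one p hD, rootNeededProb_eq p hD, Finset.prod_mul_distrib,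
    Finset.prod_Icc_succ_top (by omega : 1 ≤ n + 1) (decodableProb D p)]
  ring

end Recursion

/-! ### Expected communication cost -/

section Cost

variable {D n : ℕ} (p : ℕ → ℝ)

theorem leafJointProb_eq_zero {N : ℕ} (hN : Fintype.card (Vertex (n + 1)) + 1 ≤ N) :
    leafJointProb D p (n + 1) N = 0 :=
  prob_eq_zero fun S h => by
    have := h.2.lt
    omega

-- Linearity of expectation over the leaves. Costs are at most the number of vertices, so a finite
-- range of `N` suffices.
open Classical in
theorem sum_weight_mul_totalCost (hD : 1 ≤ D) (n : ℕ) :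
    (∑ S : Finset (Vertex (n + 1)),
      if Decodable D S then weight (layerProb p (n + 1)) S * (totalCost S : ℝ) else 0) =
    2 ^ n * ∑ N ∈ Finset.range (Fintype.card (Vertex (n + 1)) + 1),
      (N : ℝ) * leafJointProb D p (n + 1) N := by
  set M := Fintype.card (Vertex (n + 1)) + 1
  have hS : ∀ S : Finset (Vertex (n + 1)),
      (if Decodable D S then weight (layerProb p (n + 1)) S * (totalCost S : ℝ) else 0) =
      ∑ y : Leaf (n + 1), ∑ N ∈ Finset.range M, (N : ℝ) *
        if Decodable D S ∧ RecoveredWith S y N then weight (layerProb p (n + 1)) S else 0 := by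
    intro S
    by_cases hdec : Decodable D S
    · rw [if_pos hdec, totalCost_eq hD hdec,
        Finset.sum_congr rfl fun y _ => sum_recovers_eq S y M (Nat.lt_succ_self _)]
      push_cast
      rw [Finset.mul_sum]
      refine Finset.sum_congr rfl fun y _ => ?_
      rw [Finset.mul_sum]
      refine Finset.sum_congr rfl fun N _ => ?_
      by_cases h : RecoveredWith S y N
      · simp [h, hdec, mul_comm]
      · simp [h]
    · simp [hdec]
  rw [Finset.sum_congr rfl fun S _ => hS S, Finset.sum_comm]
  have hy : ∀ y : Leaf (n + 1), (∑ S : Finset (Vertex (n + 1)), ∑ N ∈ Finset.range M, (N : ℝ) *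
        if Decodable D S ∧ RecoveredWith S y N then weight (layerProb p (n + 1)) S else 0) =
      ∑ N ∈ Finset.range M, (N : ℝ) * leafJointProb D p (n + 1) N := by
    intro y
    rw [Finset.sum_comm]
    refine Finset.sum_congr rfl fun N _ => ?_
    rw [← Finset.mul_sum, ← jointProb_eq p hD y, jointProb, prob]
    refine congrArg _ (Finset.sum_congr rfl fun S _ => ?_)
    congr
  rw [Finset.sum_congr rfl fun y _ => hy y, Finset.sum_const, Finset.card_univ, card_leaf,
    nsmul_eq_mul]
  push_cast
  rfl

theorem hasSum_leafJointProb (n : ℕ) :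
    HasSum (fun N : ℕ => (N : ℝ) * leafJointProb D p (n + 1) N)
      (∑ N ∈ Finset.range (Fintype.card (Vertex (n + 1)) + 1),
        (N : ℝ) * leafJointProb D p (n + 1) N) := by
  refine hasSum_sum_of_ne_finset_zero fun N hN => ?_
  rw [Finset.mem_range, not_lt] at hN
  rw [leafJointProb_eq_zero p hN, mul_zero]

theorem expectedCost_eq (hD : 1 ≤ D) (n : ℕ) :
    expectedCost D p (n + 1) = 2 ^ n *
      ((∑' N : ℕ, (N : ℝ) * leafJointProb D p (n + 1) N) / decodableProb D p (n + 1)) := by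
  rw [expectedCost, sum_weight_mul_totalCost p hD, (hasSum_leafJointProb p n).tsum_eq,
    mul_div_assoc]

theorem condProb_eq (hD : 1 ≤ D) (y : Leaf n) (N : ℕ) :
    condProb D p n y N = leafJointProb D p n N / decodableProb D p n := by
  rw [← jointProb_eq p hD y, condProb, jointProb, decodableProb]
  congr 1
  exact prob_congr fun S => and_comm

end Cost

end Treeplication

/-! ### Assembly of the statements -/

open Treeplication in
theorem mainTheorem8 (D : ℕ) (hD : 1 ≤ D) (p : ℕ → ℝ)
    (hp : ∀ i : ℕ, 1 ≤ i → 0 ≤ p i ∧ p i ≤ 1) :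
    ∃ P A : ℕ → ℕ → ℝ,
      -- `P i N` and `A i N` are the probabilities in question, for every data fragment `y`
      (∀ (i : ℕ) (y : Leaf i) (N : ℕ), jointProb D p i y N = P i N) ∧
      (∀ (i : ℕ) (y : Leaf i) (N : ℕ), rootCondProb D p i y N = A i N) ∧
      (∀ (i : ℕ) (y : Leaf i) (N : ℕ),
        0 < prob (layerProb p i) (fun S => RootPath S y) →
        A i N =
          prob (layerProb p i)
              (fun S => (Decodable D S ∧ RecoveredWith S y N) ∧ RootPath S y) /
            prob (layerProb p i) (fun S => RootPath S y)) ∧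
      -- the recursion for `P`
      (∀ i N : ℕ, 1 < i →
        P i N =
          decodableProb D p (i - 1) * P (i - 1) N +
          A i N * p i * ∏ l ∈ Finset.Icc 1 (i - 1), (1 - p l) +
          p i * (∏ l ∈ Finset.Icc 1 (i - 1), (1 - p l)) *
            ∑ j ∈ Finset.Icc 1 (i - 1),
              2 ^ (j - 1) * P j N *
                ∏ l ∈ (Finset.Icc 1 (i - 1)).erase j, decodableProb D p l) ∧
      (∀ N : ℕ, 0 < N → P 1 N = 0) ∧
      P 1 0 = p 1 ∧
      -- the recursion for `A`
      (∀ i N : ℕ, 2 < i →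
        A i N =
          ∑ l ∈ (Finset.Icc 1 (2 ^ (i - 2))).filter (fun l => l ≤ N),
            topProb D p (i - 1) l * A (i - 1) (N - l)) ∧
      A 2 1 = p 1 ∧
      (∀ N : ℕ, N ≠ 1 → A 2 N = 0) ∧
      (∀ N : ℕ, A 1 N = 0) ∧
      -- the recursion for `F`
      (∀ i N : ℕ, 1 < i → 1 < N →
        topProb D p i N =
          (1 - p i) *
            ∑ l ∈ Finset.Icc 1 (N - 1), topProb D p (i - 1) l * topProb D p (i - 1) (N - l)) ∧
      (∀ i : ℕ, 1 < i →
        topProb D p i 1 =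
          p i * (decodableProb D p (i - 1) ^ 2 +
            2 ^ (i - 1) * ∏ j ∈ Finset.Icc 1 (i - 1), ((1 - p j) * decodableProb D p j))) ∧
      (∀ N : ℕ, 1 < N → topProb D p 1 N = 0) ∧
      topProb D p 1 1 = p 1 ∧
      -- the expected communication cost
      (∀ d : ℕ, 1 ≤ d → 0 < decodableProb D p d →
        (∀ y : Leaf d,
          Summable (fun N : ℕ => (N : ℝ) * condProb D p d y N) ∧
          expectedCost D p d = 2 ^ (d - 1) * ∑' N : ℕ, (N : ℝ) * condProb D p d y N) ∧
        Summable (fun N : ℕ => (N : ℝ) * P d N) ∧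
        expectedCost D p d =
          2 ^ (d - 1) * ((∑' N : ℕ, (N : ℝ) * P d N) / decodableProb D p d)) := by
  -- The leftmost leaf represents all leaves. The values at `i = 0` are immaterial, since `T_0` has
  -- no leaf.
  refine ⟨leafJointProb D p, leafRootCondProb D p, fun _ => jointProb_eq p hD,
    fun _ => rootCondProb_eq p hD, fun _ => leafRootCondProb_eq_div p hD, ?_, ?_, ?_, ?_, ?_, ?_,
    fun N => rootCondProb_one p _ N, ?_, ?_, ?_, ?_, ?_⟩
  · intro i N hi
    obtain ⟨n, rfl⟩ := Nat.exists_eq_add_of_le' hi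
    exact leafJointProb_succ p hD n N
  · intro N hN
    exact (jointProb_one p hD _ N).trans (if_neg hN.ne')
  · exact (jointProb_one p hD _ 0).trans (if_pos rfl)
  · intro i N hi
    obtain ⟨n, rfl⟩ := Nat.exists_eq_add_of_le' hi
    exact leafRootCondProb_succ p hD n N
  · rw [leafRootCondProb_two p hD, if_pos rfl]
  · intro N hN
    rw [leafRootCondProb_two p hD, if_neg hN]
  · intro i N hi hN
    obtain ⟨n, rfl⟩ := Nat.exists_eq_add_of_le' hi
    exact topProb_succ_Icc p hD hN
  · intro i hi
    obtain ⟨n, rfl⟩ := Nat.exists_eq_add_of_le' hi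
    exact topProb_succ_one_prod p hD
  · intro N hN
    rw [topProb_one p hD, if_neg hN.ne']
  · rw [topProb_one p hD, if_pos rfl]
  · intro d hd _
    obtain ⟨n, rfl⟩ := Nat.exists_eq_add_of_le' hd
    have hsum := (hasSum_leafJointProb (D := D) p n).summable
    refine ⟨fun y => ?_, hsum, expectedCost_eq p hD n⟩
    simp only [condProb_eq p hD, ← mul_div_assoc]
    refine ⟨hsum.div_const _, ?_⟩
    rw [tsum_div_const]
    exact expectedCost_eq p hD n
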